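/- Fix an integer $d\ge 0$. There is an algorithm (a random access machine with unit-cost instructions) with the following property. The algorithm is given the incomparability graph $G$ of an $n$-element poset $P=(V,\le)$, i.e. the graph on $V$ in which two elements are adjacent if and only if they are incomparable in $P$, together with $d$ linear orders $\le_1,\dots,\le_d$ on $V$ whose intersection is $P$, i.e. $x\le y$ if and only if $x\le_i y$ for all $i\in\{1,\dots,d\}$. It enumerates all inclusion-wise minimal dominating sets of $G$, each exactly once, and halts. Its delay is $O(n^{3d+4})$ and it uses polynomial space, where the constant in the $O$ and the polynomial depend only on $d$. That is, the number of steps before the first output, between any two consecutive outputs, and from the last output until the machine halts is at most $C_d\,(n+1)^{3d+4}$, and at any time the machine uses at most polynomially many (in $n$) memory cells, each holding a word of $O(\log n)$ bits. -/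

import Mathlib

/-! ### Incomparability graphs and minimal dominating sets -/

namespace DomEnum

/-- The incomparability graph of the poset `P`: two vertices are adjacent iff they are incomparable
(in particular, no vertex is adjacent to itself). -/
def incompGraph {V : Type*} (P : PartialOrder V) : SimpleGraph V where
  Adj u v := IncompRel P.le u v
  symm := ⟨fun _ _ h => ⟨h.2, h.1⟩⟩
  loopless := ⟨fun v h => h.1 (P.le_refl v)⟩

/-- `D` is a dominating set of `G`: every vertex is in `D` or adjacent to a vertex of `D`. -/
def IsDominating {V : Type*} (G : SimpleGraph V) (D : Finset V) : Prop :=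
  ∀ v, v ∈ D ∨ ∃ u ∈ D, G.Adj u v

/-- `D` is an inclusion-wise minimal dominating set of `G`. -/
def IsMinimalDominating {V : Type*} (G : SimpleGraph V) (D : Finset V) : Prop :=
  Minimal (IsDominating G) D

end DomEnum

/-! ### Random access machines

Programs for a random access machine, with structured control flow. The machine has a random access
input that can only be read, finitely many registers (those named in the program), a random access
working memory, and an output that can only be written. Registers and memory cells hold natural
numbers; all are `0` at the start. The output is a sequence of solutions, each of them a finite
sequence of numbers. -/

namespace Ram

/-- The arithmetical operations of the machine. Subtraction is truncated, division is
rounded down, and division by `0` gives `0`. -/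
inductive Op
  | add
  | sub
  | mul
  | div

/-- The value of an arithmetical operation. -/
def Op.eval : Op → ℕ → ℕ → ℕ
  | .add, a, b => a + b
  | .sub, a, b => a - b
  | .mul, a, b => a * b
  | .div, a, b => a / b

/-- The tests available for branching: comparisons of two registers. -/
inductive Test
  | lt (x y : ℕ)
  | eq (x y : ℕ)

/-- The outcome of a test when `reg` is the content of the registers. -/
def Test.eval (reg : ℕ → ℕ) : Test → Bool
  | .lt x y => decide (reg x < reg y)
  | .eq x y => decide (reg x = reg y)

/-- Programs. The arguments `x y z` are names of registers. -/
inductive Prog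
  /-- do nothing -/
  | skip
  /-- `x := c` -/
  | const (x c : ℕ)
  /-- `x := y o z` -/
  | op (o : Op) (x y z : ℕ)
  /-- `x := input[y]` -/
  | input (x y : ℕ)
  /-- `x := memory[y]` -/
  | load (x y : ℕ)
  /-- `memory[x] := y` -/
  | store (x y : ℕ)
  /-- append the content of `x` to the solution that is being written -/
  | print (x : ℕ)
  /-- the solution that is being written is complete; start a new one -/
  | emit
  /-- first `p`, then `q` -/
  | seq (p q : Prog)
  /-- if `t` then `p` else `q` -/
  | ite (t : Test) (p q : Prog)
  /-- while `t` do `p` -/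
  | loop (t : Test) (p : Prog)

/-- A configuration of the machine. There are no procedure calls: `code` is a stack of
subprograms of the program, whose height is bounded by the size of the program. -/
structure Config where
  /-- what remains to be executed -/
  code : List Prog
  /-- the registers -/
  reg : ℕ → ℕ
  /-- the working memory -/
  mem : ℕ → ℕ
  /-- the part already written of the next solution -/
  buf : List ℕ
  /-- the solutions output so far, in the order of their output -/
  out : List (List ℕ)

/-- The machine has halted. -/
def Config.Halted (c : Config) : Prop := c.code = []

/-- One step of the machine, at unit cost. The input is `0` beyond its end.
A machine that has halted does not change any more. -/
def step (inp : List ℕ) (c : Config) : Config :=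
  match c.code with
  | [] => c
  | .skip :: k => { c with code := k }
  | .const x v :: k => { c with code := k, reg := Function.update c.reg x v }
  | .op o x y z :: k =>
      { c with code := k, reg := Function.update c.reg x (o.eval (c.reg y) (c.reg z)) }
  | .input x y :: k => { c with code := k, reg := Function.update c.reg x (inp.getD (c.reg y) 0) }
  | .load x y :: k => { c with code := k, reg := Function.update c.reg x (c.mem (c.reg y)) }
  | .store x y :: k => { c with code := k, mem := Function.update c.mem (c.reg x) (c.reg y) }
  | .print x :: k => { c with code := k, buf := c.buf ++ [c.reg x] }
  | .emit :: k => { c with code := k, buf := [], out := c.out ++ [c.buf] }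
  | .seq p q :: k => { c with code := p :: q :: k }
  | .ite t p q :: k => { c with code := (if t.eval c.reg then p else q) :: k }
  | .loop t p :: k => { c with code := if t.eval c.reg then p :: .loop t p :: k else k }

/-- The initial configuration. -/
def init (p : Prog) : Config where
  code := [p]
  reg := fun _ => 0
  mem := fun _ => 0
  buf := []
  out := []

/-- The configuration after `t` steps of the program `p` on the input `inp`. -/
def run (p : Prog) (inp : List ℕ) (t : ℕ) : Config := (step inp)^[t] (init p)

/-- The configuration is one of a machine with `B` memory cells, where each cell and each register
holds a number below `B`, that is, a word of at most `⌈log₂ B⌉` bits. -/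
def Config.FitsIn (c : Config) (B : ℕ) : Prop :=
  (∀ x, c.reg x < B) ∧ (∀ a, c.mem a < B) ∧ ∀ a, B ≤ a → c.mem a = 0

/-- During the whole run there are at most `B` memory cells in use, and no register or
memory cell ever holds a number that is not below `B`. -/
def SpaceAtMost (p : Prog) (inp : List ℕ) (B : ℕ) : Prop :=
  ∀ t, (run p inp t).FitsIn B

/-- The delay is at most `B`: from any moment on (in particular, from the start and from the output
of any solution on), at most `B` steps pass until a solution is output or the machine halts.
So `B` bounds the time before the first output, the time between two consecutive outputs,
and the time from the last output until the machine halts. -/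
def DelayAtMost (p : Prog) (inp : List ℕ) (B : ℕ) : Prop :=
  ∀ t, ∃ s ≤ B, (run p inp (t + s)).Halted ∨
    (run p inp t).out.length < (run p inp (t + s)).out.length

end Ram

/-! ### The enumeration problem -/

namespace DomEnum

open Classical in
/-- The matrix of a binary relation on `Fin n`, with entries `0` and `1`, row by row: the entry at
position `u * n + v` tells whether `r u v` holds. -/
noncomputable def matrixCode {n : ℕ} (r : Fin n → Fin n → Prop) : List ℕ :=
  List.ofFn fun k : Fin (n * n) => if r k.divNat k.modNat then 1 else 0

/-- The input given to the machine: the number `n` of vertices, the adjacency matrix of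
the graph `G`, and the matrices of the given linear orders, one after the other. -/
noncomputable def inputCode {n d : ℕ} (G : SimpleGraph (Fin n)) (ord : Fin d → LinearOrder (Fin n)) :
    List ℕ :=
  n :: (matrixCode G.Adj ++ (List.finRange d).flatMap fun i => matrixCode (ord i).le)

/-- The list `l` of numbers lists the elements of `D`, each of them once. -/
def Lists {n : ℕ} (l : List ℕ) (D : Finset (Fin n)) : Prop :=
  l.Nodup ∧ ∀ m, m ∈ l ↔ ∃ v ∈ D, (v : ℕ) = m

/-- On the input `inp`, the program `p` halts, having output exactly the members of the family
`F`, each of them once. -/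
def Enumerates {n : ℕ} (p : Ram.Prog) (inp : List ℕ) (F : Set (Finset (Fin n))) : Prop :=
  ∃ T, (Ram.run p inp T).Halted ∧ (Ram.run p inp T).buf = [] ∧
    ∃ L : List (Finset (Fin n)), L.Nodup ∧ (∀ D, D ∈ L ↔ D ∈ F) ∧
      List.Forall₂ Lists (Ram.run p inp T).out L

end DomEnum

/-!
The program searches for the minimal dominating sets in lexicographical order. It goes through the
vertices in the order of the first of the given linear orders, which is a linear extension of the
poset `P`, and keeps a set `A` of vertices up to the current vertex `c` that can be extended to a
minimal dominating set by vertices after `c`. The search needs no recursion: it completes `A`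
greedily, outputs the result, and goes back to the last omitted vertex that can be inserted
instead (`Ram.descend`, `Ram.output`, `Ram.ascend`; the invariants are `DomEnum.Descending` and
`DomEnum.Returning`). Between two outputs there are `O(n)` tests whether a set `A` is extendable,
so all depends on a test that takes time `O(n ^ (3 * d + 3))`.

A set `A` is extendable if and only if there are private neighbours `p a` for the `a` in `A` such
that `A`, together with the vertices after `c` that dominate none of the `p a`, is a dominating
set; the vertices that are superfluous can then be removed, while those in `A` stay necessary.
There are too many choices of the `p a`, but they matter only through the set of the vertices
after `c` that dominate none of them, that is, that are comparable to and different from all of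
them. If `p a` is at most `c` in the first order, this means to be above `p a` in `P`. As for the
`p a` after `c`, no vertex `u` of a minimal dominating set is below one and above another of them:
if `p b < u < p a`, then `a`, which does not dominate `p b` and comes before it, satisfies
`a < p b < p a`, and does not dominate `p a`. So `u` is above all `p a` up to `c`, and either
above all or below all `p a` after `c`. Since `P` is the intersection of the `d` linear orders, such
conditions are expressed by three initial segments ("cuts") of each linear order, and there are
`(n + 1) ^ (3 * d)` ways to choose these. Given the cuts, it remains to look for a private
neighbour in the region determined by the cuts for each `a` separately, and to test domination,
which takes time `O(n ^ 3)`. That the cuts decide whether `A` is extendable is the content of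
`DomEnum.exists_extension_iff`.

For `d = 0` there is at most one vertex, and the program for `d = 1` is used: it does not read the
diagonals of the matrices of the linear orders in any way that matters.

For the machine, conditions are written as arithmetical expressions with bounded sums
(`Ram.Expr`), where a sum serves as a bounded quantifier. These are compiled to programs once and
for all. By `Ram.Expr.runs_compile`, the running time of a compiled expression is governed by the
nesting of its sums, and all numbers that occur are polynomially bounded. The extension test is
one such expression, `Ram.Expr.extendable`; its outermost sum runs over the numbers below
`(n + 1) ^ (3 * d)`, whose digits in base `n + 1` code the cuts.
-/

/-! ### Reasoning about runs of the machine -/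

namespace Ram

/-- A configuration without its code. -/
structure State where
  /-- the registers -/
  reg : ℕ → ℕ
  /-- the working memory -/
  mem : ℕ → ℕ
  /-- the part already written of the next solution -/
  buf : List ℕ
  /-- the solutions output so far -/
  out : List (List ℕ)

/-- The configuration with state `s` that still has to execute `k`. -/
def State.at (s : State) (k : List Prog) : Config := ⟨k, s.reg, s.mem, s.buf, s.out⟩

/-- The state after writing `v` to the register `x`. -/
def State.setReg (s : State) (x v : ℕ) : State := { s with reg := Function.update s.reg x v }

/-- The state after writing `v` to the memory cell `a`. -/
def State.setMem (s : State) (a v : ℕ) : State := { s with mem := Function.update s.mem a v }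

/-- The state respects the space bound `B`, see `Ram.Config.FitsIn`. -/
def State.Fits (s : State) (B : ℕ) : Prop :=
  (∀ x, s.reg x < B) ∧ (∀ a, s.mem a < B) ∧ ∀ a, B ≤ a → s.mem a = 0

theorem State.Fits.setReg {s : State} {B x v : ℕ} (h : s.Fits B) (hv : v < B) :
    (s.setReg x v).Fits B := by
  refine ⟨fun y => ?_, h.2⟩
  by_cases hy : y = x
  · subst hy; simpa [State.setReg] using hv
  · simpa [State.setReg, hy] using h.1 y

theorem State.Fits.setMem {s : State} {B a v : ℕ} (h : s.Fits B) (ha : a < B) (hv : v < B) :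
    (s.setMem a v).Fits B := by
  refine ⟨h.1, fun y => ?_, fun y hy => ?_⟩
  · by_cases hya : y = a
    · subst hya; simpa [State.setMem] using hv
    · simpa [State.setMem, hya] using h.2.1 y
  · have hya : y ≠ a := by omega
    simpa [State.setMem, hya] using h.2.2 y hy

/-- The machine gets from `c` to `c'` in at most `T` steps, respecting the space bound `B`. -/
def Reach (inp : List ℕ) (B T : ℕ) (c c' : Config) : Prop :=
  ∃ t ≤ T, (step inp)^[t] c = c' ∧ ∀ r ≤ t, ((step inp)^[r] c).FitsIn B

/-- Executing `p` in the state `s` takes at most `T` steps, respects the space bound `B`, and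
leads to the state `s'`. -/
def Runs (inp : List ℕ) (B T : ℕ) (p : Prog) (s s' : State) : Prop :=
  ∀ k, Reach inp B T (s.at (p :: k)) (s'.at k)

section Rules

variable {inp : List ℕ} {B T T₁ T₂ : ℕ} {c c₁ c₂ : Config} {p q : Prog} {s s₁ s₂ : State}

theorem Reach.trans (h₁ : Reach inp B T₁ c c₁) (h₂ : Reach inp B T₂ c₁ c₂) :
    Reach inp B (T₁ + T₂) c c₂ := by
  obtain ⟨t₁, ht₁, e₁, f₁⟩ := h₁
  obtain ⟨t₂, ht₂, e₂, f₂⟩ := h₂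
  refine ⟨t₂ + t₁, by omega, by rw [Function.iterate_add_apply, e₁, e₂], fun r hr => ?_⟩
  by_cases h : r ≤ t₁
  · exact f₁ r h
  · obtain ⟨u, rfl⟩ := Nat.exists_eq_add_of_le' (le_of_not_ge h)
    rw [Function.iterate_add_apply, e₁]
    exact f₂ u (by omega)

theorem Reach.mono (h : Reach inp B T₁ c c₁) (hT : T₁ ≤ T₂) : Reach inp B T₂ c c₁ := by
  obtain ⟨t, ht, e⟩ := h
  exact ⟨t, ht.trans hT, e⟩

theorem Reach.single (h : c.FitsIn B) (h' : (step inp c).FitsIn B) :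
    Reach inp B 1 c (step inp c) := by
  refine ⟨1, le_rfl, rfl, fun r hr => ?_⟩
  interval_cases r
  · exact h
  · exact h'

theorem Reach.fits_left (h : Reach inp B T c c₁) : c.FitsIn B := by
  obtain ⟨t, -, -, f⟩ := h
  exact f 0 (Nat.zero_le _)

theorem Reach.fits_right (h : Reach inp B T c c₁) : c₁.FitsIn B := by
  obtain ⟨t, -, e, f⟩ := h
  exact e ▸ f t le_rfl

theorem Runs.mono (h : Runs inp B T₁ p s s₁) (hT : T₁ ≤ T₂) : Runs inp B T₂ p s s₁ :=
  fun k => (h k).mono hT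

theorem Runs.fits_left (h : Runs inp B T p s s₁) : s.Fits B := (h []).fits_left

theorem Runs.fits_right (h : Runs inp B T p s s₁) : s₁.Fits B := (h []).fits_right

theorem runs_skip (h : s.Fits B) : Runs inp B 1 .skip s s :=
  fun k => Reach.single (c := s.at (.skip :: k)) h h

theorem runs_const {x v : ℕ} (h : s.Fits B) (hv : v < B) :
    Runs inp B 1 (.const x v) s (s.setReg x v) :=
  fun k => Reach.single (c := s.at (.const x v :: k)) h (h.setReg hv)

theorem runs_op {o : Op} {x y z : ℕ} (h : s.Fits B) (hv : o.eval (s.reg y) (s.reg z) < B) :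
    Runs inp B 1 (.op o x y z) s (s.setReg x (o.eval (s.reg y) (s.reg z))) :=
  fun k => Reach.single (c := s.at (.op o x y z :: k)) h (h.setReg hv)

theorem runs_input {x y : ℕ} (h : s.Fits B) (hv : inp.getD (s.reg y) 0 < B) :
    Runs inp B 1 (.input x y) s (s.setReg x (inp.getD (s.reg y) 0)) :=
  fun k => Reach.single (c := s.at (.input x y :: k)) h (h.setReg hv)

theorem runs_load {x y : ℕ} (h : s.Fits B) :
    Runs inp B 1 (.load x y) s (s.setReg x (s.mem (s.reg y))) :=
  fun k => Reach.single (c := s.at (.load x y :: k)) h (h.setReg (h.2.1 _))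

theorem runs_store {x y : ℕ} (h : s.Fits B) :
    Runs inp B 1 (.store x y) s (s.setMem (s.reg x) (s.reg y)) :=
  fun k => Reach.single (c := s.at (.store x y :: k)) h (h.setMem (h.1 _) (h.1 _))

theorem runs_print {x : ℕ} (h : s.Fits B) :
    Runs inp B 1 (.print x) s { s with buf := s.buf ++ [s.reg x] } :=
  fun k => Reach.single (c := s.at (.print x :: k)) h h

theorem runs_emit (h : s.Fits B) :
    Runs inp B 1 .emit s { s with buf := [], out := s.out ++ [s.buf] } :=
  fun k => Reach.single (c := s.at (.emit :: k)) h h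

theorem Runs.seq (h₁ : Runs inp B T₁ p s s₁) (h₂ : Runs inp B T₂ q s₁ s₂) :
    Runs inp B (1 + T₁ + T₂) (.seq p q) s s₂ := fun k =>
  ((Reach.single (c := s.at (.seq p q :: k)) h₁.fits_left h₁.fits_left).trans
    (h₁ (q :: k))).trans (h₂ k)

theorem Runs.ite {t : Test} (h : Runs inp B T (if t.eval s.reg then p else q) s s₁) :
    Runs inp B (1 + T) (.ite t p q) s s₁ := fun k =>
  (Reach.single (c := s.at (.ite t p q :: k)) h.fits_left h.fits_left).trans (h k)

theorem reach_loop {t : Test} {k : List Prog} (h : s.Fits B) (ht : t.eval s.reg = true) :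
    Reach inp B 1 (s.at (.loop t p :: k)) (s.at (p :: .loop t p :: k)) := by
  have := Reach.single (inp := inp) (B := B) (c := s.at (.loop t p :: k)) h h
  simpa [step, State.at, ht] using this

theorem reach_loop_exit {t : Test} {k : List Prog} (h : s.Fits B) (ht : t.eval s.reg = false) :
    Reach inp B 1 (s.at (.loop t p :: k)) (s.at k) := by
  have := Reach.single (inp := inp) (B := B) (c := s.at (.loop t p :: k)) h h
  simpa [step, State.at, ht] using this

theorem reach_seq {k : List Prog} (h : s.Fits B) :
    Reach inp B 1 (s.at (.seq p q :: k)) (s.at (p :: q :: k)) :=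
  Reach.single (c := s.at (.seq p q :: k)) h h

theorem Runs.loop {t : Test} (ht : t.eval s.reg = true) (h₁ : Runs inp B T₁ p s s₁)
    (h₂ : Runs inp B T₂ (.loop t p) s₁ s₂) : Runs inp B (1 + T₁ + T₂) (.loop t p) s s₂ :=
  fun k => ((reach_loop h₁.fits_left ht).trans (h₁ _)).trans (h₂ k)

theorem runs_loop_exit {t : Test} (h : s.Fits B) (ht : t.eval s.reg = false) :
    Runs inp B 1 (.loop t p) s s :=
  fun _ => reach_loop_exit h ht

/-- The loop rule: `I` is an invariant, and `μ` decreases with each iteration. -/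
theorem runs_loop {t : Test} (I : State → Prop) (μ : State → ℕ) (hfit : ∀ s, I s → s.Fits B)
    (hbody : ∀ s, I s → t.eval s.reg = true → ∃ s', Runs inp B T p s s' ∧ I s' ∧ μ s' < μ s)
    (s : State) (hs : I s) :
    ∃ s', Runs inp B ((T + 1) * μ s + 1) (.loop t p) s s' ∧ I s' ∧ t.eval s'.reg = false := by
  induction hm : μ s using Nat.strong_induction_on generalizing s with
  | _ m ih =>
    by_cases ht : t.eval s.reg = true
    · obtain ⟨s₁, h₁, hI, hlt⟩ := hbody s hs ht
      obtain ⟨s₂, h₂, hI₂, ht₂⟩ := ih (μ s₁) (hm ▸ hlt) s₁ hI rfl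
      refine ⟨s₂, (h₁.loop ht h₂).mono ?_, hI₂, ht₂⟩
      have := Nat.mul_le_mul_left (T + 1) (hm ▸ hlt : μ s₁ + 1 ≤ m)
      linarith
    · have ht : t.eval s.reg = false := by simpa using ht
      exact ⟨s, (runs_loop_exit (hfit s hs) ht).mono (by omega), hs, ht⟩

end Rules

/-! ### Delay, space and outcome of a run -/

theorem out_length_le_step (inp : List ℕ) (c : Config) :
    c.out.length ≤ (step inp c).out.length := by
  unfold step
  split <;> simp

theorem out_length_le_iterate (inp : List ℕ) (c : Config) (t : ℕ) :
    c.out.length ≤ ((step inp)^[t] c).out.length := by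
  induction t with
  | zero => exact le_rfl
  | succ t ih =>
    rw [Function.iterate_succ_apply']
    exact ih.trans (out_length_le_step _ _)

theorem step_halted {inp : List ℕ} {c : Config} (h : c.Halted) (t : ℕ) :
    (step inp)^[t] c = c := by
  induction t with
  | zero => rfl
  | succ t ih =>
    rw [Function.iterate_succ_apply', ih]
    unfold step
    rw [show c.code = [] from h]

/-- Within `K` steps from `c` on, the machine outputs a solution or halts. -/
def Progress (inp : List ℕ) (K : ℕ) (c : Config) : Prop :=
  ∃ s ≤ K, ((step inp)^[s] c).Halted ∨ c.out.length < ((step inp)^[s] c).out.length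

/-- The run that starts from `c` halts in a configuration satisfying `Q`, with delay at most `2 * K`
and within the space bound `B`. -/
structure Finishes (inp : List ℕ) (B K : ℕ) (Q : Config → Prop) (c : Config) : Prop where
  final : ∃ t, ((step inp)^[t] c).Halted ∧ Q ((step inp)^[t] c)
  progress : ∀ t, Progress inp (2 * K) ((step inp)^[t] c)
  fits : ∀ t, ((step inp)^[t] c).FitsIn B

section Finishes

variable {inp : List ℕ} {B K : ℕ} {Q : Config → Prop} {c c' : Config}

theorem finishes_of_halted (h : c.Halted) (hQ : Q c) (hf : c.FitsIn B) :
    Finishes inp B K Q c where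
  final := ⟨0, h, hQ⟩
  progress t := ⟨0, Nat.zero_le _, Or.inl (by rw [step_halted h]; exact h)⟩
  fits t := by rw [step_halted h]; exact hf

/-- If the rest of the run from `c'` on has a bounded delay, and the first output after `c'`
comes within `K` steps, then prepending at most `K` steps leads to a delay of at most `2 * K`: a
solution that is output on the way to `c'` is followed by another one, or by the end of the run,
within `2 * K` steps. -/
theorem Finishes.of_reach (h : Reach inp B K c c') (hp : Progress inp K c')
    (hc' : Finishes inp B K Q c') : Finishes inp B K Q c := by
  obtain ⟨t₀, ht₀, e, f⟩ := h
  have later (t : ℕ) (ht : t₀ ≤ t) : (step inp)^[t] c = (step inp)^[t - t₀] c' := by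
    rw [← e, ← Function.iterate_add_apply, Nat.sub_add_cancel ht]
  refine ⟨?_, fun t => ?_, fun t => ?_⟩
  · obtain ⟨t, h⟩ := hc'.final
    exact ⟨t + t₀, by rw [Function.iterate_add_apply, e]; exact h⟩
  · by_cases ht : t₀ ≤ t
    · rw [later t ht]; exact hc'.progress _
    · obtain ⟨s, hs, h⟩ := hp
      have e₁ : (step inp)^[t₀ - t] ((step inp)^[t] c) = c' := by
        rw [← Function.iterate_add_apply, Nat.sub_add_cancel (by omega), e]
      refine ⟨s + (t₀ - t), by omega, ?_⟩
      rw [Function.iterate_add_apply, e₁]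
      refine h.imp id fun h => lt_of_le_of_lt ?_ h
      have := out_length_le_iterate inp ((step inp)^[t] c) (t₀ - t)
      rwa [e₁] at this
  · by_cases ht : t₀ ≤ t
    · rw [later t ht]; exact hc'.fits _
    · exact f t (by omega)

theorem Progress.of_reach {T : ℕ} (h : Reach inp B T c c') (hT : T ≤ K)
    (hc : c'.Halted ∨ c.out.length < c'.out.length) : Progress inp K c := by
  obtain ⟨t, ht, e, -⟩ := h
  exact ⟨t, ht.trans hT, by rwa [e]⟩

end Finishes

end Ram

/-! ### A language of arithmetical expressions and its compiler -/

namespace Ram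

/-- Arithmetical expressions with bounded sums. A condition is represented by an expression that is
nonzero if and only if the condition holds; bounded sums then express bounded quantifiers. -/
inductive Expr
  /-- a variable -/
  | var (x : ℕ)
  /-- a constant -/
  | const (c : ℕ)
  /-- one of the two sizes that bound the sums: the large one if `big`, the small one otherwise -/
  | size (big : Bool)
  /-- an arithmetical operation -/
  | op (o : Op) (a b : Expr)
  /-- an entry of the input -/
  | input (a : Expr)
  /-- a memory cell -/
  | load (a : Expr)
  /-- the sum of the values of `e` for all values of the variable `i` below a size -/
  | sum (big : Bool) (i : ℕ) (e : Expr)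

namespace Expr

/-- The value of an expression, where `size` gives the two sizes and `ρ` the values of the
variables. -/
def eval (inp : List ℕ) (mem : ℕ → ℕ) (size : Bool → ℕ) : Expr → (ℕ → ℕ) → ℕ
  | var x, ρ => ρ x
  | const c, _ => c
  | .size big, _ => size big
  | op o a b, ρ => o.eval (eval inp mem size a ρ) (eval inp mem size b ρ)
  | input a, ρ => inp.getD (eval inp mem size a ρ) 0
  | load a, ρ => mem (eval inp mem size a ρ)
  | sum big i e, ρ =>
      ∑ k ∈ Finset.range (size big), eval inp mem size e (Function.update ρ i k)

/-- The register that holds a size. -/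
def sizeReg (big : Bool) : ℕ := if big then 1 else 0

/-- The program for `x := y`, for distinct registers `x` and `y`. -/
def copy (x y : ℕ) : Prog := .seq (.const x 0) (.op .add x x y)

/-- The program that writes the value of an expression to the register `b`. It writes to no register
below `b`; the register `Γ x` holds the value of the variable `x`. -/
def compile : Expr → (ℕ → ℕ) → ℕ → Prog
  | var x, Γ, b => copy b (Γ x)
  | const c, _, b => .const b c
  | .size big, _, b => copy b (sizeReg big)
  | op o e₁ e₂, Γ, b =>
      .seq (compile e₁ Γ b) (.seq (compile e₂ Γ (b + 1)) (.op o b b (b + 1)))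
  | input e, Γ, b => .seq (compile e Γ b) (.input b b)
  | load e, Γ, b => .seq (compile e Γ b) (.load b b)
  | sum big i e, Γ, b =>
      .seq (.const b 0) (.seq (.const (b + 1) 0) (.loop (.lt (b + 1) (sizeReg big))
        (.seq (compile e (Function.update Γ i (b + 1)) (b + 2)) (.seq (.op .add b b (b + 2))
          (.seq (.const (b + 2) 1) (.op .add (b + 1) (b + 1) (b + 2)))))))

/-- An exponent for the values of an expression and its subexpressions: if the sizes, the input,
the memory and the variables hold numbers below `X ^ W` for some `X ≥ 2`, then all these values are
below `X ^ e.valueDeg W`. -/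
def valueDeg (W : ℕ) : Expr → ℕ
  | var _ => W
  | const c => c + 1
  | .size _ => W
  | op _ a b => a.valueDeg W + b.valueDeg W
  | input a => W + a.valueDeg W
  | load a => W + a.valueDeg W
  | sum _ _ e => W + e.valueDeg W + 1

/-- The degree of the running time of a compiled expression if the two sizes are at most
`L` and `L ^ D`. -/
def timeDeg (D : ℕ) : Expr → ℕ
  | var _ => 0
  | const _ => 0
  | .size _ => 0
  | op _ a b => max (a.timeDeg D) (b.timeDeg D)
  | input a => a.timeDeg D
  | load a => a.timeDeg D
  | sum big _ e => (if big then D else 1) + e.timeDeg D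

/-- The constant factor of the running time of a compiled expression. -/
def timeConst : Expr → ℕ
  | var _ => 3
  | const _ => 1
  | .size _ => 3
  | op _ a b => a.timeConst + b.timeConst + 3
  | input a => a.timeConst + 2
  | load a => a.timeConst + 2
  | sum _ _ e => e.timeConst + 14

section Eval

variable {inp : List ℕ} {mem : ℕ → ℕ} {size : Bool → ℕ} {X W : ℕ}

theorem eval_lt (hX : 2 ≤ X) (hsize : ∀ big, size big < X ^ W) (hinp : ∀ a, inp.getD a 0 < X ^ W)
    (hmem : ∀ a, mem a < X ^ W) (e : Expr) (ρ : ℕ → ℕ) (hρ : ∀ x, ρ x < X ^ W) :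
    e.eval inp mem size ρ < X ^ e.valueDeg W := by
  have hX0 : 0 < X := by omega
  induction e generalizing ρ with
  | var x => exact hρ x
  | const c =>
    exact (Nat.lt_pow_self (by omega : 1 < X)).trans_le
      (Nat.pow_le_pow_right hX0 (by simp [valueDeg, eval]))
  | size big => exact hsize big
  | op o a b iha ihb =>
    simp only [valueDeg, pow_add]
    have ha := iha ρ hρ
    have hb := ihb ρ hρ
    simp only [eval]
    generalize eval inp mem size a ρ = x at ha ⊢
    generalize eval inp mem size b ρ = y at hb ⊢
    generalize X ^ a.valueDeg W = p at ha ⊢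
    generalize X ^ b.valueDeg W = q at hb ⊢
    have hpq : p ≤ p * q := Nat.le_mul_of_pos_right _ (by omega)
    cases o with
    | add =>
      obtain ⟨p', rfl⟩ := Nat.exists_eq_add_of_lt ha
      obtain ⟨q', rfl⟩ := Nat.exists_eq_add_of_lt hb
      simp only [Op.eval]
      nlinarith [Nat.zero_le ((x + p') * (y + q')), Nat.zero_le p', Nat.zero_le q']
    | sub => exact ((Nat.sub_le _ _).trans_lt ha).trans_le hpq
    | mul => exact Nat.mul_lt_mul'' ha hb
    | div => exact ((Nat.div_le_self _ _).trans_lt ha).trans_le hpq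
  | input a ih =>
    exact (hinp _).trans_le (Nat.pow_le_pow_right hX0 (by simp [valueDeg]))
  | load a ih =>
    exact (hmem _).trans_le (Nat.pow_le_pow_right hX0 (by simp [valueDeg]))
  | sum big i e ih =>
    have h : ∀ k ∈ Finset.range (size big),
        eval inp mem size e (Function.update ρ i k) ≤ X ^ e.valueDeg W := by
      intro k hk
      refine (ih _ fun x => ?_).le
      by_cases hx : x = i
      · subst hx; simpa using (Finset.mem_range.1 hk).trans (hsize big)
      · simpa [hx] using hρ x
    calc _ ≤ size big * X ^ e.valueDeg W := by
            simpa [eval] using Finset.sum_le_card_nsmul _ _ _ h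
      _ < X ^ W * X ^ e.valueDeg W := Nat.mul_lt_mul_of_pos_right (hsize big) (by positivity)
      _ ≤ X ^ valueDeg W (sum big i e) := by
            rw [← pow_add]; exact Nat.pow_le_pow_right hX0 (by simp [valueDeg])

end Eval

section Compile

variable {inp : List ℕ} {size : Bool → ℕ} {B X W L D : ℕ}

theorem runs_copy {s : State} (h : s.Fits B) {x y : ℕ} (hxy : y ≠ x) :
    Runs inp B 3 (copy x y) s (s.setReg x (s.reg y)) := by
  have hB : 0 < B := (Nat.zero_le _).trans_lt (h.1 0)
  have h₁ := runs_const (inp := inp) (x := x) h hB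
  have h₂ := runs_op (inp := inp) (o := .add) (x := x) (y := x) (z := y) h₁.fits_right
    (by simpa [State.setReg, Op.eval, hxy] using h.1 y)
  have h₃ := h₁.seq h₂
  simpa [copy, State.setReg, Op.eval, hxy] using h₃

/-- The compiler is correct, and the compiled programs obey the time and space bounds. -/
theorem runs_compile (hX : 2 ≤ X) (hL : 1 ≤ L) (hsize : ∀ big, size big < X ^ W)
    (hsizeL : size false ≤ L) (hsizeD : size true ≤ L ^ D) (hinp : ∀ a, inp.getD a 0 < X ^ W)
    (e : Expr) (hB : X ^ e.valueDeg W ≤ B) (Γ : ℕ → ℕ) (b : ℕ) (s : State)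
    (hb : 2 ≤ b) (hΓ : ∀ x, Γ x < b) (hs : s.Fits B) (hmem : ∀ a, s.mem a < X ^ W)
    (hρ : ∀ x, s.reg (Γ x) < X ^ W) (hreg : ∀ big, s.reg (sizeReg big) = size big) :
    ∃ s', Runs inp B (e.timeConst * L ^ e.timeDeg D) (e.compile Γ b) s s' ∧
      s'.reg b = e.eval inp s.mem size (fun x => s.reg (Γ x)) ∧ (∀ r < b, s'.reg r = s.reg r) ∧
      s'.mem = s.mem ∧ s'.buf = s.buf ∧ s'.out = s.out := by
  have hX0 : 0 < X := by omega
  have sizeReg_lt : ∀ big, sizeReg big < 2 := fun big => by cases big <;> simp [sizeReg]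
  induction e generalizing Γ b s with
  | var x =>
    refine ⟨_, (runs_copy hs (hΓ x).ne).mono (by simp [timeConst, timeDeg]), ?_, ?_, rfl, rfl, rfl⟩
    · simp [State.setReg, eval]
    · intro r hr; simp [State.setReg, hr.ne]
  | const c =>
    refine ⟨_, (runs_const (x := b) (v := c) hs ?_).mono (by simp [timeConst, timeDeg]), ?_, ?_,
      rfl, rfl, rfl⟩
    · exact (Nat.lt_pow_self (by omega : 1 < X)).trans_le
        ((Nat.pow_le_pow_right hX0 (by simp [valueDeg])).trans hB)
    · simp [State.setReg, eval]
    · intro r hr; simp [State.setReg, hr.ne]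
  | size big =>
    have := sizeReg_lt big
    refine ⟨_, (runs_copy (y := sizeReg big) (x := b) hs (by omega)).mono
      (by simp [timeConst, timeDeg]), ?_, ?_, rfl, rfl, rfl⟩
    · simp [State.setReg, eval, hreg]
    · intro r hr; simp [State.setReg, hr.ne]
  | op o e₁ e₂ ih₁ ih₂ =>
    obtain ⟨s₁, r₁, v₁, f₁, m₁, b₁, o₁⟩ := ih₁ (le_trans (Nat.pow_le_pow_right hX0
      (by simp [valueDeg])) hB) Γ b s hb hΓ hs hmem hρ hreg
    obtain ⟨s₂, r₂, v₂, f₂, m₂, b₂, o₂⟩ := ih₂ (le_trans (Nat.pow_le_pow_right hX0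
      (by simp [valueDeg])) hB) Γ (b + 1) s₁ (by omega) (fun x => (hΓ x).trans (by omega))
      r₁.fits_right (by rwa [m₁]) (fun x => by rw [f₁ _ (hΓ x)]; exact hρ x)
      (fun big => by rw [f₁ _ ((sizeReg_lt big).trans_le hb)]; exact hreg big)
    have w₁ : s₂.reg b = eval inp s.mem size e₁ fun x => s.reg (Γ x) := by
      rw [f₂ b (by omega), v₁]
    have w₂ : s₂.reg (b + 1) = eval inp s.mem size e₂ fun x => s.reg (Γ x) := by
      rw [v₂, m₁]; congr 1; funext x; exact f₁ _ (hΓ x)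
    have hv := eval_lt hX hsize hinp hmem (op o e₁ e₂) _ hρ
    have r₃ := runs_op (inp := inp) (o := o) (x := b) (y := b) (z := b + 1) r₂.fits_right
      (by rw [w₁, w₂]; exact hv.trans_le hB)
    refine ⟨_, (r₁.seq (r₂.seq r₃)).mono ?_, ?_, ?_, ?_, ?_, ?_⟩
    · simp only [timeConst, timeDeg]
      have h₁ := Nat.pow_le_pow_right hL (le_max_left (timeDeg D e₁) (timeDeg D e₂))
      have h₂ := Nat.pow_le_pow_right hL (le_max_right (timeDeg D e₁) (timeDeg D e₂))
      have h₃ := Nat.one_le_pow (max (timeDeg D e₁) (timeDeg D e₂)) L hL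
      have h₄ := Nat.mul_le_mul_left e₁.timeConst h₁
      have h₅ := Nat.mul_le_mul_left e₂.timeConst h₂
      linarith
    · simp [State.setReg, w₁, w₂, eval]
    · intro r hr; simp [State.setReg, hr.ne, f₂ r (by omega), f₁ r hr]
    · simp [State.setReg, m₁, m₂]
    · simp [State.setReg, b₁, b₂]
    · simp [State.setReg, o₁, o₂]
  | input e ih =>
    obtain ⟨s₁, r₁, v₁, f₁, m₁, b₁, o₁⟩ := ih (le_trans (Nat.pow_le_pow_right hX0
      (by simp [valueDeg])) hB) Γ b s hb hΓ hs hmem hρ hreg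
    have r₂ := runs_input (inp := inp) (x := b) (y := b) r₁.fits_right
      ((hinp _).trans_le (le_trans (Nat.pow_le_pow_right hX0 (by simp [valueDeg])) hB))
    refine ⟨_, (r₁.seq r₂).mono ?_, ?_, ?_, m₁, b₁, o₁⟩
    · simp only [timeConst, timeDeg]
      have h₃ := Nat.one_le_pow (timeDeg D e) L hL
      linarith
    · simp [State.setReg, v₁, eval]
    · intro r hr; simp [State.setReg, hr.ne, f₁ r hr]
  | load e ih =>
    obtain ⟨s₁, r₁, v₁, f₁, m₁, b₁, o₁⟩ := ih (le_trans (Nat.pow_le_pow_right hX0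
      (by simp [valueDeg])) hB) Γ b s hb hΓ hs hmem hρ hreg
    have r₂ := runs_load (inp := inp) (x := b) (y := b) r₁.fits_right
    refine ⟨_, (r₁.seq r₂).mono ?_, ?_, ?_, m₁, b₁, o₁⟩
    · simp only [timeConst, timeDeg]
      have h₃ := Nat.one_le_pow (timeDeg D e) L hL
      linarith
    · simp [State.setReg, v₁, m₁, eval]
    · intro r hr; simp [State.setReg, hr.ne, f₁ r hr]
  | sum big i e ih =>
    set ρ : ℕ → ℕ := fun x => s.reg (Γ x) with hρdef
    set f : ℕ → ℕ := fun k => eval inp s.mem size e (Function.update ρ i k) with hf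
    have hBe : X ^ e.valueDeg W ≤ B :=
      le_trans (Nat.pow_le_pow_right hX0 (by simp only [valueDeg]; omega)) hB
    have hBW : X ^ (W + 1) ≤ B :=
      le_trans (Nat.pow_le_pow_right hX0 (by simp only [valueDeg]; omega)) hB
    have hBW' : X ^ W < B := lt_of_lt_of_le (Nat.pow_lt_pow_right (by omega) (by omega)) hBW
    have h1W := Nat.one_le_pow W X hX0
    have partial_lt (j : ℕ) (hj : j ≤ size big) : ∑ k ∈ Finset.range j, f k < B :=
      calc _ ≤ ∑ k ∈ Finset.range (size big), f k :=
            Finset.sum_le_sum_of_subset (Finset.range_subset_range.2 hj)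
        _ < _ := (eval_lt hX hsize hinp hmem (sum big i e) ρ hρ).trans_le hB
    -- after `j` rounds, `b` holds the sum of the first `j` terms, and `b + 1` holds `j`
    let I : State → Prop := fun t => t.Fits B ∧ t.reg (b + 1) ≤ size big ∧
      t.reg b = ∑ k ∈ Finset.range (t.reg (b + 1)), f k ∧ (∀ r < b, t.reg r = s.reg r) ∧
      t.mem = s.mem ∧ t.buf = s.buf ∧ t.out = s.out
    have r₁ := runs_const (inp := inp) (x := b) (v := 0) hs (by omega)
    have r₂ := runs_const (inp := inp) (x := b + 1) (v := 0) r₁.fits_right (by omega)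
    have hI₀ : I ((s.setReg b 0).setReg (b + 1) 0) := by
      refine ⟨r₂.fits_right, by simp [State.setReg], by simp [State.setReg], ?_, rfl, rfl, rfl⟩
      intro r hr
      simp [State.setReg, hr.ne, show r ≠ b + 1 by omega]
    have hsz (t : State) (ht : ∀ r < b, t.reg r = s.reg r) : t.reg (sizeReg big) = size big := by
      rw [ht _ ((sizeReg_lt big).trans_le hb), hreg]
    obtain ⟨s', r₃, ⟨-, hle, hsum, hfr, hm, hbf, ho⟩, hexit⟩ := runs_loop (inp := inp) (B := B)
      (T := e.timeConst * L ^ e.timeDeg D + 6)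
      (t := .lt (b + 1) (sizeReg big))
      (p := .seq (compile e (Function.update Γ i (b + 1)) (b + 2)) (.seq (.op .add b b (b + 2))
          (.seq (.const (b + 2) 1) (.op .add (b + 1) (b + 1) (b + 2)))))
      I (fun t => size big - t.reg (b + 1)) (fun t ht => ht.1)
      (by
        rintro t ⟨hfit, hle, hsum, hfr, hm, hbf, ho⟩ htest
        have hlt : t.reg (b + 1) < size big := by
          simpa [Test.eval, hsz t hfr] using htest
        have hvar (x : ℕ) : t.reg (Function.update Γ i (b + 1) x)
            = Function.update ρ i (t.reg (b + 1)) x := by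
          by_cases hx : x = i
          · subst hx; simp
          · simp [hx, hρdef, hfr _ (hΓ x)]
        obtain ⟨s₁, q₁, v₁, f₁, m₁, b₁, o₁⟩ := ih hBe (Function.update Γ i (b + 1)) (b + 2) t
          (by omega)
          (fun x => by
            by_cases hx : x = i
            · subst hx; simp
            · simpa [hx] using (hΓ x).trans (by omega)) hfit (by rwa [hm])
          (fun x => by
            rw [hvar]
            by_cases hx : x = i
            · subst hx; simpa using hlt.trans (hsize big)
            · simpa [hx] using hρ x)
          (fun big' => by rw [hfr _ ((sizeReg_lt big').trans_le hb), hreg])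
        have e₁ : s₁.reg (b + 2) = f (t.reg (b + 1)) := by
          rw [v₁, hm]; simp only [hf]; congr 1; funext x; exact hvar x
        have e₂ : s₁.reg b + s₁.reg (b + 2) = ∑ k ∈ Finset.range (t.reg (b + 1) + 1), f k := by
          rw [Finset.sum_range_succ, ← hsum, e₁, f₁ b (by omega)]
        have q₂ := runs_op (inp := inp) (o := .add) (x := b) (y := b) (z := b + 2) q₁.fits_right
          (by simp only [Op.eval]; rw [e₂]; exact partial_lt _ hlt)
        have q₃ := runs_const (inp := inp) (x := b + 2) (v := 1) q₂.fits_right (by omega)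
        have e₃ : s₁.reg (b + 1) = t.reg (b + 1) := f₁ _ (by omega)
        have q₄ := runs_op (inp := inp) (o := .add) (x := b + 1) (y := b + 1) (z := b + 2)
          q₃.fits_right (by
            have := hsize big
            simp [State.setReg, Op.eval, e₃]
            omega)
        refine ⟨_, (q₁.seq (q₂.seq (q₃.seq q₄))).mono (by omega),
          ⟨q₄.fits_right, ?_, ?_, ?_, ?_, ?_, ?_⟩, ?_⟩
        · simp [State.setReg, Op.eval, e₃]; omega
        · simp [State.setReg, Op.eval, e₃, e₂]
        · intro r hr
          simp [State.setReg, hr.ne, show r ≠ b + 1 by omega, show r ≠ b + 2 by omega,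
            f₁ r (by omega), hfr r hr]
        · simp [State.setReg, m₁, hm]
        · simp [State.setReg, b₁, hbf]
        · simp [State.setReg, o₁, ho]
        · simp [State.setReg, Op.eval, e₃]; omega)
      _ hI₀
    have hend : s'.reg (b + 1) = size big := by
      have : ¬ s'.reg (b + 1) < size big := by simpa [Test.eval, hsz s' hfr] using hexit
      omega
    refine ⟨s', (r₁.seq (r₂.seq r₃)).mono ?_, by rw [hsum, hend, eval], hfr, hm, hbf, ho⟩
    have hsz' : size big ≤ L ^ (if big then D else 1) := by cases big <;> simpa
    have h₁ := Nat.one_le_pow (if big then D else 1) L hL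
    have h₂ := Nat.one_le_pow (timeDeg D e) L hL
    simp only [timeConst, timeDeg, pow_add]
    have e₀ : ((s.setReg b 0).setReg (b + 1) 0).reg (b + 1) = 0 := by simp [State.setReg]
    simp only [e₀, Nat.sub_zero]
    generalize L ^ (if big then D else 1) = p at *
    generalize L ^ timeDeg D e = q at *
    have h₃ : (e.timeConst * q + 6 + 1) * size big ≤ (e.timeConst * q + 7) * p :=
      Nat.mul_le_mul le_rfl hsz'
    have h₄ : p ≤ p * q := Nat.le_mul_of_pos_right _ h₂
    calc _ ≤ 5 + (e.timeConst * q + 6 + 1) * size big := by omega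
      _ ≤ (e.timeConst + 14) * (p * q) := by nlinarith

end Compile

end Expr

end Ram

/-! ### Extending a set of vertices to a minimal dominating set -/

namespace DomEnum

section Dominating

variable {V : Type*} {G : SimpleGraph V}

/-- `u` dominates `v`, that is, `u` lies in the closed neighbourhood of `v`. -/
def Dom (G : SimpleGraph V) (u v : V) : Prop := u = v ∨ G.Adj u v

theorem isDominating_iff {D : Finset V} : IsDominating G D ↔ ∀ v, ∃ u ∈ D, Dom G u v := by
  refine forall_congr' fun v => ⟨?_, ?_⟩
  · rintro (h | ⟨u, hu, h⟩)
    · exact ⟨v, h, Or.inl rfl⟩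
    · exact ⟨u, hu, Or.inr h⟩
  · rintro ⟨u, hu, rfl | h⟩
    · exact Or.inl hu
    · exact Or.inr ⟨u, hu, h⟩

/-- Every vertex of a minimal dominating set has a private neighbour. -/
theorem IsMinimalDominating.exists_private [DecidableEq V] {D : Finset V}
    (h : IsMinimalDominating G D) {a : V} (ha : a ∈ D) :
    ∃ p, Dom G a p ∧ ∀ b ∈ D, b ≠ a → ¬ Dom G b p := by
  have hnot : ¬ IsDominating G (D.erase a) := fun h' =>
    (Finset.erase_ssubset ha).not_subset (h.2 h' (Finset.erase_subset a D))
  rw [isDominating_iff] at hnot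
  push Not at hnot
  obtain ⟨p, hp⟩ := hnot
  have hp' : ∀ b ∈ D, b ≠ a → ¬ Dom G b p := fun b hb hba => hp b (Finset.mem_erase.2 ⟨hba, hb⟩)
  obtain ⟨u, hu, hup⟩ := isDominating_iff.1 h.1 p
  have : u = a := by_contra fun hua => hp' u hu hua hup
  exact ⟨p, this ▸ hup, hp'⟩

/-- A dominating set contains a minimal one, which has to contain all vertices that have a private
neighbour. -/
theorem exists_isMinimalDominating {D : Finset V} (hD : IsDominating G D) :
    ∃ D' ⊆ D, IsMinimalDominating G D' ∧
      ∀ a ∈ D, (∃ p, ∀ b ∈ D, b ≠ a → ¬ Dom G b p) → a ∈ D' := by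
  obtain ⟨D', hle, hmin⟩ := exists_minimal_le_of_wellFoundedLT (IsDominating G) D hD
  refine ⟨D', hle, hmin, ?_⟩
  rintro a ha ⟨p, hp⟩
  obtain ⟨u, hu, hup⟩ := isDominating_iff.1 hmin.1 p
  have : u = a := by_contra fun hua => hp u (hle hu) hua hup
  exact this ▸ hu

end Dominating

section Cuts

variable {n : ℕ}

/-- The initial segment of the linear order `o` with code `k`: it is empty if `k = 0`, and its
greatest element is `k - 1` otherwise. -/
def InCut (o : LinearOrder (Fin n)) (k : ℕ) (x : Fin n) : Prop :=
  ∃ y : Fin n, y + 1 = k ∧ o.le x y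

theorem InCut.le_of_le {o : LinearOrder (Fin n)} {k : ℕ} {x y : Fin n} (h : InCut o k y)
    (hxy : o.le x y) : InCut o k x := by
  obtain ⟨z, hz, hyz⟩ := h
  exact ⟨z, hz, o.le_trans _ _ _ hxy hyz⟩

/-- Every initial segment has a code. -/
theorem exists_inCut_iff (o : LinearOrder (Fin n)) (Q : Fin n → Prop)
    (hQ : ∀ x y, o.le x y → Q y → Q x) : ∃ k < n + 1, ∀ x, InCut o k x ↔ Q x := by
  classical
  by_cases hne : ∃ y, Q y
  · obtain ⟨y₀, hy₀⟩ := hne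
    obtain ⟨y, hy, hmax⟩ := @Set.Finite.exists_maximal (Fin n) ⟨o.le⟩
      ⟨o.le_trans⟩ {y | Q y} (Set.toFinite _) ⟨y₀, hy₀⟩
    refine ⟨y + 1, by omega, fun x => ⟨?_, fun hx => ⟨y, rfl, ?_⟩⟩⟩
    · rintro ⟨z, hz, hxz⟩
      have : z = y := Fin.ext (by omega)
      exact hQ x y (this ▸ hxz) hy
    · exact (o.le_total x y).elim id fun h => hmax hx h
  · refine ⟨0, by omega, fun x => ⟨?_, fun hx => (hne ⟨x, hx⟩).elim⟩⟩
    rintro ⟨z, hz, -⟩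
    omega

end Cuts

section Extension

variable {n d : ℕ} {P : PartialOrder (Fin n)} {ord : Fin d → LinearOrder (Fin n)}

theorem not_dom_iff {x p : Fin n} :
    ¬ Dom (incompGraph P) x p ↔ x ≠ p ∧ (P.le x p ∨ P.le p x) := by
  simp only [Dom, incompGraph, IncompRel, not_or, not_and_or, not_not]

/-- The vertices that the cuts `l`, `m`, `h` allow as private neighbours. -/
def Allowed (ord : Fin d → LinearOrder (Fin n)) (l m h : Fin d → ℕ) (p : Fin n) : Prop :=
  (∀ j, InCut (ord j) (l j) p) ∨ ∀ j, ¬ InCut (ord j) (m j) p ∧ InCut (ord j) (h j) p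

/-- The vertices that dominate no allowed vertex, because they are above all vertices allowed by `l`
and either above or below all vertices allowed by `m` and `h`. -/
def Free (ord : Fin d → LinearOrder (Fin n)) (l m h : Fin d → ℕ) (x : Fin n) : Prop :=
  (∀ j, ¬ InCut (ord j) (l j) x) ∧
    ((∀ j, ¬ InCut (ord j) (h j) x) ∨ ∀ j, InCut (ord j) (m j) x)

/-- The cuts `l`, `m`, `h` certify that the set of the vertices `u ≤ c` (in the order `ord i₀`) with
`A u` can be extended to a minimal dominating set by vertices that come after `c`. -/
def Certifies (P : PartialOrder (Fin n)) (ord : Fin d → LinearOrder (Fin n)) (i₀ : Fin d)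
    (c : Fin n) (A : Fin n → Prop) (l m h : Fin d → ℕ) : Prop :=
  (∀ a, (ord i₀).le a c ∧ A a → ∃ p, Dom (incompGraph P) a p ∧ Allowed ord l m h p ∧
    ∀ b, (ord i₀).le b c ∧ A b → b ≠ a → ¬ Dom (incompGraph P) b p) ∧
  ∀ v, ∃ u, Dom (incompGraph P) u v ∧
    ((ord i₀).le u c ∧ A u ∨ ¬ (ord i₀).le u c ∧ Free ord l m h u)

theorem not_dom_of_free (hP : ∀ x y, P.le x y ↔ ∀ i, (ord i).le x y) (i₀ : Fin d)
    {l m h : Fin d → ℕ} {p x : Fin n} (hp : Allowed ord l m h p) (hx : Free ord l m h x) :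
    ¬ Dom (incompGraph P) x p := by
  have above : (∀ j, ¬ (ord j).le x p) → ¬ Dom (incompGraph P) x p := fun H =>
    not_dom_iff.2 ⟨fun e => H i₀ (e ▸ (ord i₀).le_refl _),
      Or.inr ((hP _ _).2 fun j => ((ord j).le_total x p).resolve_left (H j))⟩
  have below : (∀ j, ¬ (ord j).le p x) → ¬ Dom (incompGraph P) x p := fun H =>
    not_dom_iff.2 ⟨fun e => H i₀ (e ▸ (ord i₀).le_refl _),
      Or.inl ((hP _ _).2 fun j => ((ord j).le_total x p).resolve_right (H j))⟩
  rcases hp with hp | hp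
  · exact above fun j hle => hx.1 j ((hp j).le_of_le hle)
  · rcases hx.2 with hx | hx
    · exact above fun j hle => hx j ((hp j).2.le_of_le hle)
    · exact below fun j hle => (hp j).1 ((hx j).le_of_le hle)

theorem exists_extension_of_certifies (hP : ∀ x y, P.le x y ↔ ∀ i, (ord i).le x y) {i₀ : Fin d}
    {c : Fin n} {A : Fin n → Prop} {l m h : Fin d → ℕ} (H : Certifies P ord i₀ c A l m h) :
    ∃ D, IsMinimalDominating (incompGraph P) D ∧ ∀ u, (ord i₀).le u c → (u ∈ D ↔ A u) := by
  classical
  let D₀ : Finset (Fin n) := {u | (ord i₀).le u c ∧ A u ∨ ¬ (ord i₀).le u c ∧ Free ord l m h u}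
  have hD₀ : IsDominating (incompGraph P) D₀ := isDominating_iff.2 fun v => by
    obtain ⟨u, huv, hu⟩ := H.2 v
    exact ⟨u, by simpa [D₀] using hu, huv⟩
  obtain ⟨D, hsub, hmin, hpriv⟩ := exists_isMinimalDominating hD₀
  refine ⟨D, hmin, fun u huc => ⟨fun hu => ?_, fun hu => hpriv u ?_ ?_⟩⟩
  · have := hsub hu
    simp only [D₀, Finset.mem_filter, Finset.mem_univ, true_and] at this
    exact this.elim (fun h => h.2) fun h => (h.1 huc).elim
  · simp [D₀, huc, hu]
  · obtain ⟨p, -, hal, hp⟩ := H.1 u ⟨huc, hu⟩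
    refine ⟨p, fun b hb hbu => ?_⟩
    simp only [D₀, Finset.mem_filter, Finset.mem_univ, true_and] at hb
    rcases hb with hb | hb
    · exact hp b hb hbu
    · exact not_dom_of_free hP i₀ hal hb.2

/-- The private neighbours `p a` are recorded by the cuts: `l` is the lower closure of those up to
`c`, `h` is the lower closure of those after `c`, and `m` consists of the vertices below all the
latter. A vertex `u` after `c` of the minimal dominating set cannot be between two private
neighbours `p a`, `p b` after `c`: if `p b < u < p a`, then `a < p b`, as `a` comes before
`p b` and does not dominate it; so `a < p a`, a contradiction. -/
theorem exists_certifies_of_extension (hP : ∀ x y, P.le x y ↔ ∀ i, (ord i).le x y) {i₀ : Fin d}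
    {c : Fin n} {A : Fin n → Prop} {D : Finset (Fin n)}
    (hD : IsMinimalDominating (incompGraph P) D) (hDA : ∀ u, (ord i₀).le u c → (u ∈ D ↔ A u)) :
    ∃ l m h : Fin d → ℕ, (∀ j, l j < n + 1) ∧ (∀ j, m j < n + 1) ∧ (∀ j, h j < n + 1) ∧
      Certifies P ord i₀ c A l m h := by
  classical
  have hex : ∀ a, ∃ p, a ∈ D → Dom (incompGraph P) a p ∧
      ∀ b ∈ D, b ≠ a → ¬ Dom (incompGraph P) b p := fun a => by
    by_cases ha : a ∈ D
    · exact (hD.exists_private ha).imp fun p hp _ => hp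
    · exact ⟨a, fun h => (ha h).elim⟩
  choose p hp using hex
  have trans₀ := (ord i₀).le_trans
  have le₀ : ∀ {x y}, P.le x y → (ord i₀).le x y := fun h => (hP _ _).1 h i₀
  have not_le : ∀ {x y} (j : Fin d), x ≠ y → P.le x y → ¬ (ord j).le y x := fun j hne h h' =>
    hne ((ord j).le_antisymm _ _ ((hP _ _).1 h j) h')
  have hcut (j : Fin d) (Q : Fin n → Prop) (hQ : ∀ x y, (ord j).le x y → Q y → Q x) :=
    exists_inCut_iff (ord j) Q hQ
  choose l hl hlQ using fun j => hcut j
    (fun x => ∃ a ∈ D, (ord i₀).le a c ∧ (ord i₀).le (p a) c ∧ (ord j).le x (p a))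
    (fun x y hxy ⟨a, ha, hac, hpc, h⟩ => ⟨a, ha, hac, hpc, (ord j).le_trans _ _ _ hxy h⟩)
  choose h hh hhQ using fun j => hcut j
    (fun x => ∃ a ∈ D, (ord i₀).le a c ∧ ¬ (ord i₀).le (p a) c ∧ (ord j).le x (p a))
    (fun x y hxy ⟨a, ha, hac, hpc, h⟩ => ⟨a, ha, hac, hpc, (ord j).le_trans _ _ _ hxy h⟩)
  choose m hm hmQ using fun j => hcut j
    (fun x => ∀ a ∈ D, (ord i₀).le a c → ¬ (ord i₀).le (p a) c → ¬ (ord j).le (p a) x)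
    (fun x y hxy H a ha hac hpc hx => H a ha hac hpc ((ord j).le_trans _ _ _ hx hxy))
  refine ⟨l, m, h, hl, hm, hh, ?_, fun v => ?_⟩
  · rintro a ⟨hac, ha⟩
    have haD := (hDA a hac).2 ha
    refine ⟨p a, (hp a haD).1, ?_, fun b hb hba => (hp a haD).2 b ((hDA b hb.1).2 hb.2) hba⟩
    by_cases hpc : (ord i₀).le (p a) c
    · exact Or.inl fun j => (hlQ j _).2 ⟨a, haD, hac, hpc, (ord j).le_refl _⟩
    · refine Or.inr fun j => ⟨fun hin => ?_, (hhQ j _).2 ⟨a, haD, hac, hpc, (ord j).le_refl _⟩⟩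
      exact (hmQ j _).1 hin a haD hac hpc ((ord j).le_refl _)
  · obtain ⟨u, hu, huv⟩ := isDominating_iff.1 hD.1 v
    refine ⟨u, huv, ?_⟩
    by_cases huc : (ord i₀).le u c
    · exact Or.inl ⟨huc, (hDA u huc).1 hu⟩
    refine Or.inr ⟨huc, ?_⟩
    have comp : ∀ a ∈ D, (ord i₀).le a c → u ≠ p a ∧ (P.le u (p a) ∨ P.le (p a) u) :=
      fun a ha hac => not_dom_iff.1 ((hp a ha).2 u hu fun e => huc (e ▸ hac))
    refine ⟨fun j hin => ?_, ?_⟩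
    · obtain ⟨a, ha, hac, hpc, hle⟩ := (hlQ j _).1 hin
      obtain ⟨hne, h₁ | h₁⟩ := comp a ha hac
      · exact huc (trans₀ _ _ _ (le₀ h₁) hpc)
      · exact not_le j hne.symm h₁ hle
    by_cases hbelow : ∃ a ∈ D, (ord i₀).le a c ∧ ¬ (ord i₀).le (p a) c ∧ P.le u (p a)
    · obtain ⟨a, ha, hac, hpc, hup⟩ := hbelow
      refine Or.inr fun j => (hmQ j u).2 fun b hb hbc hpbc => ?_
      obtain ⟨hne, h₁ | h₁⟩ := comp b hb hbc
      · exact not_le j hne h₁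
      exfalso
      have hne' := (comp a ha hac).1
      have hba : P.le (p b) (p a) := P.le_trans _ _ _ h₁ hup
      by_cases hab : a = b
      · subst hab
        exact hne' (P.le_antisymm _ _ hup h₁)
      obtain ⟨hapb, h₂ | h₂⟩ := not_dom_iff.1 ((hp b hb).2 a ha hab)
      · refine not_dom_iff.2 ⟨?_, Or.inl (P.le_trans _ _ _ h₂ hba)⟩ (hp a ha).1
        rintro e
        exact hpc (e ▸ hac)
      · exact hpbc (trans₀ _ _ _ (le₀ h₂) hac)
    · refine Or.inl fun j hin => ?_
      obtain ⟨a, ha, hac, hpc, hle⟩ := (hhQ j _).1 hin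
      obtain ⟨hne, h₁ | h₁⟩ := comp a ha hac
      · exact hbelow ⟨a, ha, hac, hpc, h₁⟩
      · exact not_le j hne.symm h₁ hle

/-- A set of vertices up to `c` extends to a minimal dominating set if and only if some
`3 * d` numbers certify this. -/
theorem exists_extension_iff (hP : ∀ x y, P.le x y ↔ ∀ i, (ord i).le x y) (i₀ : Fin d)
    (c : Fin n) (A : Fin n → Prop) :
    (∃ D, IsMinimalDominating (incompGraph P) D ∧ ∀ u, (ord i₀).le u c → (u ∈ D ↔ A u)) ↔
      ∃ l m h : Fin d → ℕ, (∀ j, l j < n + 1) ∧ (∀ j, m j < n + 1) ∧ (∀ j, h j < n + 1) ∧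
        Certifies P ord i₀ c A l m h :=
  ⟨fun ⟨_, hD, hDA⟩ => exists_certifies_of_extension hP hD hDA,
    fun ⟨_, _, _, _, _, _, H⟩ => exists_extension_of_certifies hP H⟩

theorem exists_isMinimalDominating_univ {V : Type*} [Fintype V] (G : SimpleGraph V) :
    ∃ D, IsMinimalDominating G D := by
  obtain ⟨D, -, hD, -⟩ := exists_isMinimalDominating (G := G) (D := Finset.univ)
    fun v => Or.inl (Finset.mem_univ v)
  exact ⟨D, hD⟩

end Extension

end DomEnum

/-! ### Enumeration in lexicographical order -/

namespace DomEnum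

section Search

variable {n : ℕ} {rk : Fin n → ℕ} {F : Set (Finset (Fin n))} {L : List (Finset (Fin n))} {i : ℕ}
  {A : ℕ → ℕ} {D : Finset (Fin n)} {v : Fin n}

/-- The set `D` agrees with the set with indicator `A` on the vertices of rank below `i`. -/
def Agrees (rk : Fin n → ℕ) (i : ℕ) (A : ℕ → ℕ) (D : Finset (Fin n)) : Prop :=
  ∀ u, rk u < i → (u ∈ D ↔ A u ≠ 0)

/-- The set `D` comes lexicographically before all sets that agree with `A` up to rank `i`: at the
first vertex where they differ, which has rank below `i`, the set `D` omits the vertex. -/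
def Precedes (rk : Fin n → ℕ) (i : ℕ) (A : ℕ → ℕ) (D : Finset (Fin n)) : Prop :=
  ∃ v, rk v < i ∧ v ∉ D ∧ A v ≠ 0 ∧ Agrees rk (rk v) A D

/-- The search goes down: the part of `A` up to rank `i` extends to a member of `F`, and the
members of `F` that come before all its extensions have been found already. -/
structure Descending (rk : Fin n → ℕ) (F : Set (Finset (Fin n))) (L : List (Finset (Fin n)))
    (i : ℕ) (A : ℕ → ℕ) : Prop where
  exists_agrees : ∃ D ∈ F, Agrees rk i A D
  mem_iff : ∀ D ∈ F, D ∈ L ↔ Precedes rk i A D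

/-- The search goes back up: the members of `F` that come before, or are, an extension of
the part of `A` up to rank `i` have been found already. -/
def Returning (rk : Fin n → ℕ) (F : Set (Finset (Fin n))) (L : List (Finset (Fin n)))
    (i : ℕ) (A : ℕ → ℕ) : Prop :=
  ∀ D ∈ F, D ∈ L ↔ Precedes rk i A D ∨ Agrees rk i A D

theorem agrees_update (hv : i ≤ rk v) (b : ℕ) :
    Agrees rk i (Function.update A v b) D ↔ Agrees rk i A D := by
  refine forall₂_congr fun u hu => ?_
  have : (u : ℕ) ≠ v := fun h => by have := Fin.ext h; subst this; omega
  rw [Function.update_of_ne this]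

theorem precedes_update (hv : i ≤ rk v) (b : ℕ) :
    Precedes rk i (Function.update A v b) D ↔ Precedes rk i A D := by
  refine exists_congr fun u => and_congr_right fun hu => ?_
  have : (u : ℕ) ≠ v := fun h => by have := Fin.ext h; subst this; omega
  rw [Function.update_of_ne this, agrees_update (by omega)]

theorem agrees_succ (hrk : Function.Injective rk) (hv : rk v = i) :
    Agrees rk (i + 1) A D ↔ Agrees rk i A D ∧ (v ∈ D ↔ A v ≠ 0) := by
  refine ⟨fun h => ⟨fun u hu => h u (by omega), h v (by omega)⟩, fun h u hu => ?_⟩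
  by_cases hui : rk u = i
  · rw [hrk (hui.trans hv.symm)]; exact h.2
  · exact h.1 u (by omega)

theorem precedes_succ (hrk : Function.Injective rk) (hv : rk v = i) :
    Precedes rk (i + 1) A D ↔ Precedes rk i A D ∨ v ∉ D ∧ A v ≠ 0 ∧ Agrees rk i A D := by
  constructor
  · rintro ⟨u, hu, h⟩
    by_cases hui : rk u = i
    · obtain rfl := hrk (hui.trans hv.symm)
      exact Or.inr (hv ▸ h)
    · exact Or.inl ⟨u, by omega, h⟩
  · rintro (⟨u, hu, h⟩ | h)
    · exact ⟨u, by omega, h⟩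
    · exact ⟨v, by omega, hv.symm ▸ h⟩

theorem Descending.omit (hrk : Function.Injective rk) (hv : rk v = i)
    (h : Descending rk F L i A)
    (hex : ∃ D ∈ F, Agrees rk (i + 1) (Function.update A v 0) D) :
    Descending rk F L (i + 1) (Function.update A v 0) where
  exists_agrees := hex
  mem_iff D hD := by
    rw [h.mem_iff D hD, precedes_succ hrk hv, precedes_update hv.ge]
    simp

theorem Descending.insert (hrk : Function.Injective rk) (hv : rk v = i)
    (h : Descending rk F L i A)
    (hex : ¬ ∃ D ∈ F, Agrees rk (i + 1) (Function.update A v 0) D) :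
    Descending rk F L (i + 1) (Function.update A v 1) := by
  have hmem : ∀ D ∈ F, Agrees rk i A D → v ∈ D := fun D hD hag => by
    by_contra hvD
    refine hex ⟨D, hD, (agrees_succ hrk hv).2 ⟨(agrees_update hv.ge _).2 hag, ?_⟩⟩
    simp [hvD]
  refine ⟨?_, fun D hD => ?_⟩
  · obtain ⟨D, hD, hag⟩ := h.exists_agrees
    refine ⟨D, hD, (agrees_succ hrk hv).2 ⟨(agrees_update hv.ge _).2 hag, ?_⟩⟩
    simp [hmem D hD hag]
  · rw [h.mem_iff D hD, precedes_succ hrk hv, precedes_update hv.ge, agrees_update hv.ge]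
    have := hmem D hD
    tauto

theorem Returning.of_ne_zero (hrk : Function.Injective rk) (hv : rk v = i)
    (h : Returning rk F L (i + 1) A) (hA : A v ≠ 0) :
    Returning rk F L i (Function.update A v 1) := fun D hD => by
  rw [h D hD, precedes_succ hrk hv, agrees_succ hrk hv, precedes_update hv.ge,
    agrees_update hv.ge]
  tauto

theorem Returning.of_eq_zero (hrk : Function.Injective rk) (hv : rk v = i)
    (h : Returning rk F L (i + 1) A) (hA : A v = 0)
    (hex : ¬ ∃ D ∈ F, Agrees rk (i + 1) (Function.update A v 1) D) :
    Returning rk F L i (Function.update A v 1) := fun D hD => by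
  have hmem : Agrees rk i A D → v ∉ D := fun hag hvD => by
    refine hex ⟨D, hD, (agrees_succ hrk hv).2 ⟨(agrees_update hv.ge _).2 hag, ?_⟩⟩
    simp [hvD]
  rw [h D hD, precedes_succ hrk hv, agrees_succ hrk hv, precedes_update hv.ge,
    agrees_update hv.ge]
  tauto

theorem Returning.turn (hrk : Function.Injective rk) (hv : rk v = i)
    (h : Returning rk F L (i + 1) A) (hA : A v = 0)
    (hex : ∃ D ∈ F, Agrees rk (i + 1) (Function.update A v 1) D) :
    Descending rk F L (i + 1) (Function.update A v 1) where
  exists_agrees := hex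
  mem_iff D hD := by
    rw [h D hD, precedes_succ hrk hv, precedes_succ hrk hv, agrees_succ hrk hv,
      precedes_update hv.ge, agrees_update hv.ge]
    simp [hA]
    tauto

/-- The set with indicator `A`. -/
def toSet (n : ℕ) (A : ℕ → ℕ) : Finset (Fin n) := {u | A u ≠ 0}

theorem agrees_iff_eq (hrk : ∀ u, rk u < n) : Agrees rk n A D ↔ D = toSet n A := by
  simp [Agrees, hrk, toSet, Finset.ext_iff]

theorem Descending.found (hrk : ∀ u, rk u < n) (h : Descending rk F L n A) :
    toSet n A ∈ F ∧ toSet n A ∉ L ∧ Returning rk F (L ++ [toSet n A]) n A := by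
  obtain ⟨D, hD, hag⟩ := h.exists_agrees
  obtain rfl := (agrees_iff_eq hrk).1 hag
  refine ⟨hD, ?_, fun D hD => ?_⟩
  · rw [h.mem_iff _ hD]
    rintro ⟨v, -, hvD, hA, -⟩
    exact hvD (by simpa [toSet] using hA)
  · rw [List.mem_append, h.mem_iff D hD, agrees_iff_eq hrk, List.mem_singleton]

theorem descending_zero (hF : F.Nonempty) : Descending rk F [] 0 A where
  exists_agrees := hF.imp fun D hD => ⟨hD, fun u hu => absurd hu (Nat.not_lt_zero _)⟩
  mem_iff D _ := by simp [Precedes]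

theorem Returning.mem_of_zero (h : Returning rk F L 0 A) (hD : D ∈ F) : D ∈ L :=
  (h D hD).2 (Or.inr fun _ hu => absurd hu (Nat.not_lt_zero _))

end Search

/-! ### Ranks in a linear order -/

section Rank

variable {n : ℕ} (o : LinearOrder (Fin n))

open Classical in
/-- The number of elements strictly below `u` in the order `o`. -/
noncomputable def rank (u : Fin n) : ℕ := Finset.card {w | w ≠ u ∧ o.le w u}

theorem rank_lt (u : Fin n) : rank o u < n := by
  classical
  have : Finset.card {w | w ≠ u ∧ o.le w u} < (Finset.univ : Finset (Fin n)).card :=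
    Finset.card_lt_card (Finset.ssubset_univ_iff.2 fun h => by
      have := h ▸ Finset.mem_univ u
      simp at this)
  simpa [rank] using this

variable {o}

theorem rank_lt_rank {u v : Fin n} (hne : u ≠ v) (h : o.le u v) : rank o u < rank o v := by
  classical
  refine Finset.card_lt_card ((Finset.ssubset_iff_of_subset fun w hw => ?_).2 ⟨u, ?_, ?_⟩)
  · simp only [Finset.mem_filter, Finset.mem_univ, true_and] at hw ⊢
    refine ⟨?_, o.le_trans _ _ _ hw.2 h⟩
    rintro rfl
    exact hne (o.le_antisymm _ _ h hw.2)
  · simp [hne, h]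
  · simp

theorem rank_lt_succ_iff {u v : Fin n} : rank o u < rank o v + 1 ↔ o.le u v := by
  by_cases h : u = v
  · subst h; simp
  rcases o.le_total u v with h' | h'
  · simpa [h'] using (rank_lt_rank h h').le
  · have h₁ := rank_lt_rank (Ne.symm h) h'
    exact ⟨fun h₂ => by omega, fun h₂ => (h (o.le_antisymm _ _ h₂ h')).elim⟩

theorem rank_injective : Function.Injective (rank o) := fun u v h => by
  by_contra hne
  rcases o.le_total u v with h' | h'
  · exact (rank_lt_rank hne h').ne h
  · exact (rank_lt_rank (Ne.symm hne) h').ne h.symm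

theorem exists_rank_eq {i : ℕ} (hi : i < n) : ∃ v, rank o v = i := by
  have hinj : Function.Injective fun u => (⟨rank o u, rank_lt o u⟩ : Fin n) :=
    fun u v h => rank_injective (by simpa using h)
  obtain ⟨v, hv⟩ := (Finite.injective_iff_surjective.1 hinj) ⟨i, hi⟩
  exact ⟨v, by simpa using hv⟩

end Rank

end DomEnum

/-! ### Conditions as expressions -/

namespace Ram.Expr

/-- The expression, read as a condition, is true. -/
def Holds (inp : List ℕ) (mem : ℕ → ℕ) (size : Bool → ℕ) (e : Expr) (ρ : ℕ → ℕ) : Prop :=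
  e.eval inp mem size ρ ≠ 0

/-- negation -/
def not (e : Expr) : Expr := .op .sub (.const 1) e
/-- conjunction, and multiplication of numbers -/
def and (e f : Expr) : Expr := .op .mul e f
/-- disjunction, and addition of numbers -/
def or (e f : Expr) : Expr := .op .add e f
/-- equality -/
def eq (e f : Expr) : Expr := not (or (.op .sub e f) (.op .sub f e))
/-- bounded existential quantification -/
def ex (big : Bool) (i : ℕ) (e : Expr) : Expr := .sum big i e
/-- bounded universal quantification -/
def all (big : Bool) (i : ℕ) (e : Expr) : Expr := not (ex big i (not e))
/-- conjunction of finitely many conditions -/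
def conj {ι : Type*} (l : List ι) (e : ι → Expr) : Expr := (l.map e).foldr and (.const 1)

section Logic

variable {inp : List ℕ} {mem : ℕ → ℕ} {size : Bool → ℕ} {e f : Expr} {ρ : ℕ → ℕ}

theorem eval_not : (not e).eval inp mem size ρ = 1 - e.eval inp mem size ρ := rfl

theorem eval_and : (and e f).eval inp mem size ρ =
    e.eval inp mem size ρ * f.eval inp mem size ρ := rfl

theorem eval_or : (or e f).eval inp mem size ρ =
    e.eval inp mem size ρ + f.eval inp mem size ρ := rfl

theorem holds_not : (not e).Holds inp mem size ρ ↔ ¬ e.Holds inp mem size ρ := by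
  simp only [Holds, eval_not]; omega

theorem holds_and : (and e f).Holds inp mem size ρ ↔
    e.Holds inp mem size ρ ∧ f.Holds inp mem size ρ := by
  simp only [Holds, eval_and]; exact mul_ne_zero_iff

theorem holds_or : (or e f).Holds inp mem size ρ ↔
    e.Holds inp mem size ρ ∨ f.Holds inp mem size ρ := by
  simp only [Holds, eval_or]; omega

theorem eval_eq : (eq e f).eval inp mem size ρ =
    if e.eval inp mem size ρ = f.eval inp mem size ρ then 1 else 0 := by
  simp only [eq, eval_not, eval_or, eval, Op.eval]; split <;> omega

theorem holds_eq : (eq e f).Holds inp mem size ρ ↔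
    e.eval inp mem size ρ = f.eval inp mem size ρ := by
  simp [Holds, eval_eq]

theorem holds_ex {big : Bool} {i : ℕ} : (ex big i e).Holds inp mem size ρ ↔
    ∃ k < size big, e.Holds inp mem size (Function.update ρ i k) := by
  simp [Holds, ex, eval]

theorem holds_all {big : Bool} {i : ℕ} : (all big i e).Holds inp mem size ρ ↔
    ∀ k < size big, e.Holds inp mem size (Function.update ρ i k) := by
  simp [all, holds_not, holds_ex]

theorem holds_conj {ι : Type*} {l : List ι} {e : ι → Expr} :
    (conj l e).Holds inp mem size ρ ↔ ∀ j ∈ l, (e j).Holds inp mem size ρ := by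
  induction l with
  | nil => simp [conj, Holds, eval]
  | cons a l ih => rw [List.forall_mem_cons, ← ih, ← holds_and]; rfl

theorem eval_not_not : (not (not e)).eval inp mem size ρ =
    if e.eval inp mem size ρ ≠ 0 then 1 else 0 := by
  simp only [eval_not]; split <;> omega

variable {D : ℕ}

theorem timeDeg_not : (not e).timeDeg D = e.timeDeg D := by simp [not, timeDeg]

theorem timeDeg_and : (and e f).timeDeg D = max (e.timeDeg D) (f.timeDeg D) := rfl

theorem timeDeg_or : (or e f).timeDeg D = max (e.timeDeg D) (f.timeDeg D) := rfl

theorem timeDeg_eq : (eq e f).timeDeg D = max (e.timeDeg D) (f.timeDeg D) := by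
  simp [eq, timeDeg_not, timeDeg_or, timeDeg, max_comm]

theorem timeDeg_ex_false {i : ℕ} : (ex false i e).timeDeg D = 1 + e.timeDeg D := by
  simp [ex, timeDeg]

theorem timeDeg_ex_true {i : ℕ} : (ex true i e).timeDeg D = D + e.timeDeg D := by
  simp [ex, timeDeg]

theorem timeDeg_all_false {i : ℕ} : (all false i e).timeDeg D = 1 + e.timeDeg D := by
  simp [all, timeDeg_not, timeDeg_ex_false]

theorem timeDeg_conj {ι : Type*} {l : List ι} {e : ι → Expr} (h : ∀ j, (e j).timeDeg D = 0) :
    (conj l e).timeDeg D = 0 := by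
  induction l with
  | nil => rfl
  | cons a l ih =>
    change max ((e a).timeDeg D) ((conj l e).timeDeg D) = 0
    rw [h, ih]; rfl

end Logic

/-! ### The extension test as an expression

The input consists of the adjacency matrix and of the matrices of `d` linear orders, the first of
which is the one in which the search goes through the vertices. Variable `3` is the current vertex,
the memory holds the indicator of the current set, and variable `10` codes the `3 * d` cuts, as the
digits of a number in base `n + 1`. -/

/-- the number `n + 1` -/
def base : Expr := or (.size false) (.const 1)

/-- the number `(n + 1) ^ t` -/
def pow : ℕ → Expr
  | 0 => .const 1
  | t + 1 => and (pow t) base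

/-- the digit number `t` of the variable `10` in base `n + 1` -/
def digit (t : ℕ) : Expr :=
  .op .sub (.op .div (.var 10) (pow t))
    (and (.op .div (.op .div (.var 10) (pow t)) base) base)

/-- the position of the pair `(x, y)` in a matrix -/
def pos (x y : Expr) : Expr := or (and x (.size false)) y

/-- `x` dominates `y` -/
def dom (x y : Expr) : Expr := or (eq x y) (.input (or (.const 1) (pos x y)))

/-- `x` is at most `y` in the linear order number `j` -/
def le (j : ℕ) (x y : Expr) : Expr :=
  or (eq x y) (.input (or (.const 1)
    (or (and (and (.size false) (.size false)) (.const (j + 1))) (pos x y))))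

/-- `x` lies in the cut of the linear order number `j` with code `k` -/
def inCut (j : ℕ) (k x : Expr) : Expr := and k (le j x (.op .sub k (.const 1)))

/-- `x` is allowed as a private neighbour -/
def allowed (d : ℕ) (x : Expr) : Expr :=
  or (conj (List.finRange d) fun j => inCut j (digit j) x)
    (conj (List.finRange d) fun j =>
      and (not (inCut j (digit (d + j)) x)) (inCut j (digit (2 * d + j)) x))

/-- `x` dominates no allowed vertex, by its position with respect to the cuts -/
def free (d : ℕ) (x : Expr) : Expr :=
  and (conj (List.finRange d) fun j => not (inCut j (digit j) x))
    (or (conj (List.finRange d) fun j => not (inCut j (digit (2 * d + j)) x))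
      (conj (List.finRange d) fun j => inCut j (digit (d + j)) x))

/-- `x` is at most the current vertex and belongs to the current set -/
def chosen (x : Expr) : Expr := and (le 0 x (.var 3)) (.load x)

/-- the chosen vertices have allowed private neighbours -/
def privates (d : ℕ) : Expr :=
  all false 11 (or (not (chosen (.var 11))) (ex false 12 (and (dom (.var 11) (.var 12))
    (and (allowed d (.var 12)) (all false 13 (or (not (chosen (.var 13)))
      (or (eq (.var 13) (.var 11)) (not (dom (.var 13) (.var 12))))))))))

/-- the chosen vertices and the free vertices that come after the current one dominate everything -/
def dominated (d : ℕ) : Expr :=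
  all false 14 (ex false 15 (and (dom (.var 15) (.var 14)) (or (chosen (.var 15))
    (and (not (le 0 (.var 15) (.var 3))) (free d (.var 15))))))

/-- the chosen vertices extend to a minimal dominating set by vertices that come after the current
one -/
def extendable (d : ℕ) : Expr := ex true 10 (and (privates d) (dominated d))

/-- the rank of `x` in the first linear order -/
def rank (x : Expr) : Expr :=
  .sum false 15 (not (not (and (not (eq (.var 15) x)) (le 0 (.var 15) x))))

/-- the vertex whose rank is the value of the variable `2` -/
def vertex : Expr := .sum false 14 (and (.var 14) (eq (rank (.var 14)) (.var 2)))

section Time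

variable {D : ℕ}

theorem timeDeg_pow (t : ℕ) : (pow t).timeDeg D = 0 := by
  induction t with
  | zero => rfl
  | succ t ih => simp [pow, timeDeg_and, ih, base, timeDeg_or, timeDeg]

theorem timeDeg_digit (t : ℕ) : (digit t).timeDeg D = 0 := by
  simp [digit, timeDeg_and, timeDeg_pow, base, timeDeg_or, timeDeg]

theorem timeDeg_dom {x y : Expr} : (dom x y).timeDeg D = max (x.timeDeg D) (y.timeDeg D) := by
  simp [dom, pos, timeDeg_and, timeDeg_or, timeDeg, timeDeg_eq]

theorem timeDeg_le {j : ℕ} {x y : Expr} :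
    (le j x y).timeDeg D = max (x.timeDeg D) (y.timeDeg D) := by
  simp [le, pos, timeDeg_and, timeDeg_or, timeDeg, timeDeg_eq]

theorem timeDeg_inCut (j t x : ℕ) : (inCut j (digit t) (.var x)).timeDeg D = 0 := by
  simp [inCut, timeDeg_and, timeDeg_le, timeDeg, timeDeg_digit]

theorem timeDeg_allowed (d x : ℕ) : (allowed d (.var x)).timeDeg D = 0 := by
  simp [allowed, timeDeg_or, timeDeg_conj, timeDeg_and, timeDeg_not, timeDeg_inCut]

theorem timeDeg_free (d x : ℕ) : (free d (.var x)).timeDeg D = 0 := by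
  simp [free, timeDeg_or, timeDeg_conj, timeDeg_and, timeDeg_not, timeDeg_inCut]

theorem timeDeg_chosen (x : ℕ) : (chosen (.var x)).timeDeg D = 0 := by
  simp [chosen, timeDeg_and, timeDeg_le, timeDeg]

theorem timeDeg_extendable (d : ℕ) : (extendable d).timeDeg D = D + 3 := by
  simp [extendable, privates, dominated, timeDeg_ex_true, timeDeg_ex_false, timeDeg_all_false,
    timeDeg_and, timeDeg_or, timeDeg_not, timeDeg_eq, timeDeg_dom, timeDeg_le, timeDeg_allowed,
    timeDeg_free, timeDeg_chosen, timeDeg]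

theorem timeDeg_vertex : vertex.timeDeg D = 2 := by
  simp [vertex, rank, timeDeg_and, timeDeg_not, timeDeg_eq, timeDeg_le, timeDeg]

end Time

open DomEnum

/-- The input `inp` describes the graph `G` and the linear orders `ord`. Nothing is assumed
about the diagonals of the matrices of the linear orders. -/
structure Describes {n d : ℕ} (inp : List ℕ) (G : SimpleGraph (Fin n))
    (ord : Fin d → LinearOrder (Fin n)) : Prop where
  size : inp.getD 0 0 = n
  adj : ∀ u v : Fin n, inp.getD (1 + (u * n + v)) 0 ≠ 0 ↔ G.Adj u v
  le : ∀ (j : Fin d) (u v : Fin n), u ≠ v →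
    (inp.getD (1 + (n * n * (j + 1) + (u * n + v))) 0 ≠ 0 ↔ (ord j).le u v)
  entry_le : ∀ a, inp.getD a 0 ≤ n + 1

/-- The sizes that bound the sums. -/
def sizes (n d : ℕ) (big : Bool) : ℕ := if big then (n + 1) ^ (3 * d) else n

section Semantics

variable {n d : ℕ} {inp : List ℕ} {G : SimpleGraph (Fin n)} {ord : Fin d → LinearOrder (Fin n)}
  {mem : ℕ → ℕ} {ρ : ℕ → ℕ} {x y k : Expr} {u v : Fin n}

theorem eval_base {size : Bool → ℕ} :
    base.eval inp mem size ρ = size false + 1 := rfl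

theorem eval_pow {size : Bool → ℕ} (t : ℕ) :
    (pow t).eval inp mem size ρ = (size false + 1) ^ t := by
  induction t with
  | zero => rfl
  | succ t ih => rw [pow, eval_and, ih, eval_base, pow_succ]

theorem eval_digit (t : ℕ) :
    (digit t).eval inp mem (sizes n d) ρ = ρ 10 / (n + 1) ^ t % (n + 1) := by
  have h := Nat.mod_eq_sub_div_mul (x := ρ 10 / (n + 1) ^ t) (k := n + 1)
  rw [h]
  simp [digit, eval, Op.eval, eval_and, eval_pow, eval_base, sizes]

theorem holds_dom (h : Describes inp G ord) (hx : x.eval inp mem (sizes n d) ρ = u)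
    (hy : y.eval inp mem (sizes n d) ρ = v) :
    (dom x y).Holds inp mem (sizes n d) ρ ↔ Dom G u v := by
  rw [dom, holds_or, holds_eq, hx, hy, Dom, Fin.ext_iff, ← h.adj]
  simp [Holds, pos, eval, eval_and, eval_or, hx, hy, sizes]

theorem holds_le (h : Describes inp G ord) (j : Fin d) (hx : x.eval inp mem (sizes n d) ρ = u)
    (hy : y.eval inp mem (sizes n d) ρ = v) :
    (le j x y).Holds inp mem (sizes n d) ρ ↔ (ord j).le u v := by
  rw [le, holds_or, holds_eq, hx, hy]
  by_cases huv : u = v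
  · subst huv; simpa using (ord j).le_refl u
  · have := Fin.val_ne_of_ne huv
    rw [← h.le j u v huv]
    simp [this, Holds, pos, eval, eval_and, eval_or, hx, hy, sizes]

theorem holds_inCut (h : Describes inp G ord) (j : Fin d)
    (hk : k.eval inp mem (sizes n d) ρ < n + 1) (hx : x.eval inp mem (sizes n d) ρ = u) :
    (inCut j k x).Holds inp mem (sizes n d) ρ ↔
      InCut (ord j) (k.eval inp mem (sizes n d) ρ) u := by
  rw [inCut, holds_and]
  by_cases h0 : k.eval inp mem (sizes n d) ρ = 0
  · have : ¬ k.Holds inp mem (sizes n d) ρ := by simpa [Holds] using h0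
    simp [this, InCut, h0]
  · have h₁ : k.Holds inp mem (sizes n d) ρ := h0
    rw [holds_le (v := ⟨k.eval inp mem (sizes n d) ρ - 1, by omega⟩) h j hx
      (by simp [eval, Op.eval])]
    refine ⟨fun h₂ => ⟨_, by simp; omega, h₂.2⟩, ?_⟩
    rintro ⟨w, hw, h₂⟩
    refine ⟨h₁, ?_⟩
    convert h₂ using 1
    exact Fin.ext (by simp; omega)

theorem holds_inCut_digit (h : Describes inp G ord) (j : Fin d) (t : ℕ)
    (hx : x.eval inp mem (sizes n d) ρ = u) :
    (inCut j (digit t) x).Holds inp mem (sizes n d) ρ ↔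
      InCut (ord j) (ρ 10 / (n + 1) ^ t % (n + 1)) u := by
  have := eval_digit (inp := inp) (mem := mem) (n := n) (d := d) (ρ := ρ) t
  rw [holds_inCut h j (by rw [this]; exact Nat.mod_lt _ (by omega)) hx, this]

theorem holds_allowed (h : Describes inp G ord) (hx : x.eval inp mem (sizes n d) ρ = u) :
    (allowed d x).Holds inp mem (sizes n d) ρ ↔
      Allowed ord (fun j => ρ 10 / (n + 1) ^ (j : ℕ) % (n + 1))
        (fun j => ρ 10 / (n + 1) ^ (d + j : ℕ) % (n + 1))
        (fun j => ρ 10 / (n + 1) ^ (2 * d + j : ℕ) % (n + 1)) u := by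
  simp [allowed, Allowed, holds_or, holds_conj, holds_and, holds_not, holds_inCut_digit h _ _ hx]

theorem holds_free (h : Describes inp G ord) (hx : x.eval inp mem (sizes n d) ρ = u) :
    (free d x).Holds inp mem (sizes n d) ρ ↔
      Free ord (fun j => ρ 10 / (n + 1) ^ (j : ℕ) % (n + 1))
        (fun j => ρ 10 / (n + 1) ^ (d + j : ℕ) % (n + 1))
        (fun j => ρ 10 / (n + 1) ^ (2 * d + j : ℕ) % (n + 1)) u := by
  simp [free, Free, holds_or, holds_conj, holds_and, holds_not, holds_inCut_digit h _ _ hx]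

theorem holds_chosen (h : Describes inp G ord) {i₀ : Fin d} (hi₀ : (i₀ : ℕ) = 0) {c : Fin n}
    (hc : ρ 3 = c) (hx : x.eval inp mem (sizes n d) ρ = u) :
    (chosen x).Holds inp mem (sizes n d) ρ ↔ (ord i₀).le u c ∧ mem u ≠ 0 := by
  rw [chosen, holds_and, ← holds_le h i₀ hx (y := .var 3) hc, hi₀]
  simp [Holds, eval, hx]

/-- The digits of the numbers below `(n + 1) ^ (3 * d)` in base `n + 1` are all triples of
sequences of length `d` of numbers up to `n`. -/
theorem exists_digits_iff (Q : (Fin d → ℕ) → (Fin d → ℕ) → (Fin d → ℕ) → Prop) :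
    (∃ g < (n + 1) ^ (3 * d), Q (fun j => g / (n + 1) ^ (j : ℕ) % (n + 1))
        (fun j => g / (n + 1) ^ (d + j : ℕ) % (n + 1))
        (fun j => g / (n + 1) ^ (2 * d + j : ℕ) % (n + 1))) ↔
      ∃ l m h : Fin d → ℕ, (∀ j, l j < n + 1) ∧ (∀ j, m j < n + 1) ∧ (∀ j, h j < n + 1) ∧
        Q l m h := by
  constructor
  · rintro ⟨g, -, hg⟩
    exact ⟨_, _, _, fun j => Nat.mod_lt _ (by omega), fun j => Nat.mod_lt _ (by omega),
      fun j => Nat.mod_lt _ (by omega), hg⟩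
  · rintro ⟨l, m, h, hl, hm, hh, hQ⟩
    let f : Fin (3 * d) → Fin (n + 1) := fun t =>
      if h₁ : (t : ℕ) < d then ⟨l ⟨t, h₁⟩, hl _⟩
      else if h₂ : (t : ℕ) < 2 * d then ⟨m ⟨t - d, by omega⟩, hm _⟩
      else ⟨h ⟨t - 2 * d, by omega⟩, hh _⟩
    have key (t : Fin (3 * d)) :
        (finFunctionFinEquiv f : ℕ) / (n + 1) ^ (t : ℕ) % (n + 1) = f t := by
      conv_rhs => rw [← finFunctionFinEquiv.symm_apply_apply f]
      rfl
    refine ⟨finFunctionFinEquiv f, (finFunctionFinEquiv f).2, ?_⟩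
    convert hQ using 1
    · funext j
      rw [key ⟨j, by omega⟩]
      simp [f]
    · funext j
      rw [key ⟨d + j, by omega⟩]
      have : d + (j : ℕ) < 2 * d := by omega
      simp [f, this]
    · funext j
      rw [key ⟨2 * d + j, by omega⟩]
      have h₁ : ¬ 2 * d + (j : ℕ) < d := by omega
      simp [f, h₁]

variable {P : PartialOrder (Fin n)}

theorem holds_extendable (hP : ∀ x y, P.le x y ↔ ∀ i, (ord i).le x y)
    (h : Describes inp (incompGraph P) ord) {i₀ : Fin d} (hi₀ : (i₀ : ℕ) = 0) {c : Fin n}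
    (hc : ρ 3 = c) :
    (extendable d).Holds inp mem (sizes n d) ρ ↔
      ∃ D ∈ {D | IsMinimalDominating (incompGraph P) D},
        Agrees (DomEnum.rank (ord i₀)) (DomEnum.rank (ord i₀) c + 1) mem D := by
  have hag : ∀ D, Agrees (DomEnum.rank (ord i₀)) (DomEnum.rank (ord i₀) c + 1) mem D ↔
      ∀ u, (ord i₀).le u c → (u ∈ D ↔ mem u ≠ 0) := fun D => by
    simp only [Agrees, rank_lt_succ_iff]
  simp only [Set.mem_ofPred_eq, hag]
  rw [exists_extension_iff hP i₀ c (fun u => mem u ≠ 0), ← exists_digits_iff, extendable, holds_ex]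
  refine exists_congr fun g => and_congr_right fun _ => ?_
  have lift (Q : ℕ → Prop) : (∀ k < n, Q k) ↔ ∀ u : Fin n, Q u := 
    ⟨fun H u => H u u.2, fun H k hk => H ⟨k, hk⟩⟩
  have lift' (Q : ℕ → Prop) : (∃ k < n, Q k) ↔ ∃ u : Fin n, Q u :=
    ⟨fun ⟨k, hk, hQ⟩ => ⟨⟨k, hk⟩, hQ⟩, fun ⟨u, hQ⟩ => ⟨u, u.2, hQ⟩⟩
  rw [holds_and]
  refine and_congr ?_ ?_
  · rw [privates, holds_all, show sizes n d false = n from rfl, lift]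
    refine forall_congr' fun a => ?_
    rw [holds_or, holds_not, holds_chosen (u := a) h hi₀ (c := c) (by simpa) (by simp [eval]),
      ← imp_iff_not_or, holds_ex, show sizes n d false = n from rfl, lift']
    refine imp_congr_right fun _ => exists_congr fun p => ?_
    rw [holds_and, holds_and, holds_dom (u := a) (v := p) h (by simp [eval]) (by simp [eval]),
      holds_allowed (u := p) h (by simp [eval]), holds_all, show sizes n d false = n from rfl, lift]
    refine and_congr_right fun _ => and_congr (by simp) (forall_congr' fun b => ?_)
    rw [holds_or, holds_or, holds_not, holds_not,
      holds_chosen (u := b) h hi₀ (c := c) (by simpa) (by simp [eval]),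
      holds_dom (u := b) (v := p) h (by simp [eval]) (by simp [eval]), holds_eq]
    simp only [eval, ne_eq]
    simp [← Fin.ext_iff]
    tauto
  · rw [dominated, holds_all, show sizes n d false = n from rfl, lift]
    refine forall_congr' fun v => ?_
    rw [holds_ex, show sizes n d false = n from rfl, lift']
    refine exists_congr fun u => ?_
    rw [holds_and, holds_or, holds_and, holds_not,
      holds_dom (u := u) (v := v) h (by simp [eval]) (by simp [eval]),
      holds_chosen (u := u) h hi₀ (c := c) (by simpa) (by simp [eval]), ← hi₀,
      holds_le (u := u) (v := c) h i₀ (by simp [eval]) (by simpa [eval]),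
      holds_free (u := u) h (by simp [eval])]
    simp

theorem eval_rank (h : Describes inp G ord) {i₀ : Fin d} (hi₀ : (i₀ : ℕ) = 0) {z : ℕ}
    (hz : z ≠ 15) (hx : ρ z = u) :
    (rank (.var z)).eval inp mem (sizes n d) ρ = DomEnum.rank (ord i₀) u := by
  classical
  rw [rank, eval, show sizes n d false = n from rfl, Finset.sum_range, DomEnum.rank,
    Finset.card_filter]
  refine Finset.sum_congr rfl fun w _ => ?_
  rw [eval_not_not]
  congr 1
  refine propext (Iff.trans (b := Holds _ _ _ _ _) Iff.rfl ?_)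
  rw [holds_and, holds_not, holds_eq, ← hi₀, holds_le (u := w) (v := u) h i₀ (by simp [eval])
    (by simpa [eval, hz] using hx)]
  simp [eval, hz, hx, Fin.ext_iff]

theorem eval_vertex (h : Describes inp G ord) {i₀ : Fin d} (hi₀ : (i₀ : ℕ) = 0)
    (hv : DomEnum.rank (ord i₀) v = ρ 2) :
    vertex.eval inp mem (sizes n d) ρ = v := by
  rw [vertex, eval, show sizes n d false = n from rfl, Finset.sum_range, Finset.sum_eq_single v]
  · rw [eval_and, eval_eq, eval_rank (u := v) h hi₀ (by decide) (by simp)]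
    simp [eval, hv]
  · intro w _ hw
    rw [eval_and, eval_eq, eval_rank (u := w) h hi₀ (by decide) (by simp)]
    have : DomEnum.rank (ord i₀) w ≠ ρ 2 := fun h' => hw (rank_injective (h'.trans hv.symm))
    simp [eval, this]
  · simp

end Semantics

end Ram.Expr

/-! ### The program

Registers `0` and `1` hold the sizes `n` and `(n + 1) ^ (3 * d)`, register `2` the rank of the next
vertex, register `3` the current vertex, register `4` controls the inner loops, register `5` holds
the outcome of the last test, register `6` the former value of a memory cell, and register `7` is
always `0`. The memory cell `u` tells whether the vertex `u` belongs to the current set. -/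

namespace Ram

open DomEnum Ram.Expr

/-- The registers that hold the variables of the expressions: those below `16` hold the
variables of the same name, and those from `16` on serve for the evaluation of expressions. -/
def varReg (x : ℕ) : ℕ := if x < 16 then x else 0

/-- The values of the variables. -/
def State.env (s : State) (x : ℕ) : ℕ := s.reg (varReg x)

/-- The assignment `x := e`. -/
def assign (x : ℕ) (e : Expr) : Prog := .seq (e.compile varReg 16) (copy x 16)

/-- Given a prefix that extends to a solution, the rank of the next vertex being in register `2`,
write the lexicographically first such solution to the memory: omit each vertex if possible. -/
def descend (d : ℕ) : Prog :=
  .loop (.lt 2 0) (.seq (assign 3 vertex) (.seq (assign 5 (.const 0)) (.seq (.store 3 5)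
    (.seq (assign 5 (not (extendable d))) (.seq (.store 3 5)
      (assign 2 (or (.var 2) (.const 1))))))))

/-- Output the solution in the memory. -/
def output : Prog :=
  .seq (assign 4 (.const 0)) (.seq (.loop (.lt 4 0) (.seq (assign 5 (.load (.var 4)))
    (.seq (.ite (.lt 7 5) (.print 4) .skip) (assign 4 (or (.var 4) (.const 1)))))) .emit)

/-- Go back to the last vertex that can be inserted instead of being omitted, and insert it.
Register `5` tells whether there is such a vertex. -/
def ascend (d : ℕ) : Prog :=
  .seq (assign 5 (.const 0)) (.seq (assign 4 (.var 2)) (.seq (.loop (.lt 7 4)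
    (.seq (assign 2 (.op .sub (.var 2) (.const 1))) (.seq (assign 3 vertex)
      (.seq (assign 6 (.load (.var 3))) (.seq (assign 5 (.const 1)) (.seq (.store 3 5)
        (.seq (assign 5 (and (not (.var 6)) (not (not (extendable d)))))
          (assign 4 (and (not (.var 5)) (.var 2))))))))))
    (assign 2 (or (.var 2) (.var 5)))))

/-- Find and output the next solution, and prepare the search for the one after it. -/
def round (d : ℕ) : Prog := .seq (descend d) (.seq output (ascend d))

/-- Initialize the registers that hold the sizes. -/
def setup (d : ℕ) : Prog :=
  .seq (assign 0 (.input (.const 0))) (.seq (assign 1 (pow (3 * d))) (assign 5 (.const 1)))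

/-- The enumeration of the minimal dominating sets by lexicographical search. -/
def enumerate (d : ℕ) : Prog := .seq (setup d) (.loop (.lt 7 5) (round d))

/-- The expressions that occur in the program. -/
def exprs (d : ℕ) : List Expr :=
  [.const 0, .const 1, vertex, not (extendable d), or (.var 2) (.const 1), .load (.var 4),
    or (.var 4) (.const 1), .var 2, .op .sub (.var 2) (.const 1), .load (.var 3),
    and (not (.var 6)) (not (not (extendable d))), and (not (.var 5)) (.var 2),
    or (.var 2) (.var 5), .input (.const 0), pow (3 * d)]

/-- An exponent for the space used by the expressions of the program. -/
def spaceDeg (d : ℕ) : ℕ := ((exprs d).map fun e => e.valueDeg (3 * d + 1)).sum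

/-- A bound for the running time of an assignment. -/
def assignTime (d n : ℕ) : ℕ := (((exprs d).map timeConst).sum + 4) * (n + 1) ^ (3 * d + 3)

theorem valueDeg_le {d : ℕ} {e : Expr} (he : e ∈ exprs d) :
    e.valueDeg (3 * d + 1) ≤ spaceDeg d :=
  List.single_le_sum (by simp) _ (List.mem_map_of_mem he)

theorem timeDeg_le_of_mem {d : ℕ} {e : Expr} (he : e ∈ exprs d) :
    e.timeDeg (3 * d) ≤ 3 * d + 3 := by
  simp only [exprs, List.mem_cons, List.not_mem_nil, or_false] at he
  rcases he with rfl | rfl | rfl | rfl | rfl | rfl | rfl | rfl | rfl | rfl | rfl | rfl | rfl | rfl |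
    rfl <;> simp [timeDeg, timeDeg_not, timeDeg_and, timeDeg_or, timeDeg_extendable,
      timeDeg_vertex, timeDeg_pow]

theorem time_le_assignTime {d n : ℕ} {e : Expr} (he : e ∈ exprs d) :
    e.timeConst * (n + 1) ^ e.timeDeg (3 * d) + 4 ≤ assignTime d n := by
  have h₁ : e.timeConst ≤ ((exprs d).map timeConst).sum :=
    List.single_le_sum (by simp) _ (List.mem_map_of_mem he)
  have h₂ := Nat.pow_le_pow_right (Nat.succ_pos n) (timeDeg_le_of_mem he)
  have h₃ := Nat.one_le_pow (3 * d + 3) (n + 1) (Nat.succ_pos n)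
  have h₄ := Nat.mul_le_mul h₁ h₂
  simp only [Nat.succ_eq_add_one] at h₄
  rw [assignTime, add_mul]
  omega

/-- The concrete state `s` implements `σ`: it fits into the space bound and agrees with `σ` except
for the registers that serve for the evaluation of expressions. -/
structure Implements (B : ℕ) (s σ : State) : Prop where
  fits : s.Fits B
  reg : ∀ r < 16, s.reg r = σ.reg r
  mem : s.mem = σ.mem
  buf : s.buf = σ.buf
  out : s.out = σ.out

theorem Implements.env {B : ℕ} {s σ : State} (h : Implements B s σ) : s.env = σ.env := by
  funext x
  exact h.reg _ (by unfold varReg; split <;> omega)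

/-- An assignment, for any sizes that are small enough. -/
theorem runs_assign {inp : List ℕ} {size : Bool → ℕ} {B n d : ℕ} {e : Expr}
    (hsize : size false ≤ n) (hsize' : size true ≤ (n + 1) ^ (3 * d))
    (hinp : ∀ a, inp.getD a 0 ≤ n + 1) (hB : (n + 2) ^ spaceDeg d ≤ B) (he : e ∈ exprs d) {x : ℕ}
    (hx : x < 16) {σ : State} (hmem : ∀ a, σ.mem a ≤ 1)
    (hreg : ∀ r < 16, σ.reg r ≤ (n + 1) ^ (3 * d + 1))
    (hregs : ∀ big, σ.reg (sizeReg big) = size big) {s : State} (hs : Implements B s σ) :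
    ∃ s', Runs inp B (assignTime d n) (assign x e) s s' ∧
      Implements B s' (σ.setReg x (e.eval inp σ.mem size σ.env)) := by
  -- the sizes and variables are below `(n + 2) ^ (3 * d + 1)`, the number `(n + 1) ^ (3 * d)` of
  -- choices of the cuts being the largest of them
  have hpow : (n + 1) ^ (3 * d + 1) < (n + 2) ^ (3 * d + 1) :=
    Nat.pow_lt_pow_left (by omega) (by omega)
  have hle (a : ℕ) (ha : a ≤ 3 * d + 1) : (n + 1) ^ a < (n + 2) ^ (3 * d + 1) :=
    (Nat.pow_le_pow_right (by omega) ha).trans_lt hpow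
  have h1 := hle 1 (by omega)
  rw [pow_one] at h1
  have hvar (y : ℕ) : varReg y < 16 := by unfold varReg; split <;> omega
  obtain ⟨s₁, r₁, v₁, f₁, m₁, b₁, o₁⟩ := runs_compile (X := n + 2) (L := n + 1) (D := 3 * d)
    (W := 3 * d + 1) (B := B) (size := size) (inp := inp) (by omega) (by omega)
    (fun big => by
      cases big
      · omega
      · exact hsize'.trans_lt (hle _ (by omega)))
    (by omega) hsize' (fun a => (hinp a).trans_lt h1) e
    ((Nat.pow_le_pow_right (by omega) (valueDeg_le he)).trans hB) varReg 16 s (by omega) hvar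
    hs.fits (fun a => by rw [hs.mem]; have := hmem a; omega)
    (fun y => by rw [hs.reg _ (hvar y)]; exact (hreg _ (hvar y)).trans_lt hpow)
    (fun big => by rw [hs.reg _ (by cases big <;> simp [sizeReg])]; exact hregs big)
  have r₂ := runs_copy (inp := inp) (x := x) (y := 16) r₁.fits_right (by omega)
  refine ⟨_, (r₁.seq r₂).mono ?_, r₂.fits_right, fun r hr => ?_, ?_, ?_, ?_⟩
  · have := time_le_assignTime (n := n) he
    omega
  · by_cases hrx : r = x
    · subst hrx
      have : (fun y => s.reg (varReg y)) = σ.env := hs.env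
      simp [State.setReg, v₁, hs.mem, this]
    · simp [State.setReg, hrx, f₁ r hr, hs.reg r hr]
  · simp [State.setReg, m₁, hs.mem]
  · simp [State.setReg, b₁, hs.buf]
  · simp [State.setReg, o₁, hs.out]

/-- The part of the invariants that all programs after the setup maintain. -/
structure Good (n d : ℕ) (σ : State) : Prop where
  size : ∀ big, σ.reg (sizeReg big) = sizes n d big
  zero : σ.reg 7 = 0
  reg_le : ∀ r < 16, r ≠ 1 → σ.reg r ≤ n + 1
  mem_le : ∀ a, σ.mem a ≤ 1

theorem Good.reg_zero {n d : ℕ} {σ : State} (h : Good n d σ) : σ.reg 0 = n := h.size false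

theorem Good.setReg {n d : ℕ} {σ : State} (h : Good n d σ) {x v : ℕ} (hx : 2 ≤ x ∧ x ≠ 7)
    (hv : v ≤ n + 1) : Good n d (σ.setReg x v) where
  size big := by
    have : sizeReg big ≠ x := by cases big <;> simp [sizeReg] <;> omega
    simpa [State.setReg, this] using h.size big
  zero := by simpa [State.setReg, hx.2.symm] using h.zero
  reg_le r hr hr1 := by
    by_cases hrx : r = x
    · subst hrx; simpa [State.setReg] using hv
    · simpa [State.setReg, hrx] using h.reg_le r hr hr1
  mem_le := h.mem_le

/-- Executing `p` takes at most `T` steps and leads from `σ` to `σ'`, up to the registers that serve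
for the evaluation of expressions. -/
def Leads (inp : List ℕ) (B n d T : ℕ) (p : Prog) (σ σ' : State) : Prop :=
  Good n d σ → Good n d σ' ∧ ∀ s, Implements B s σ → ∃ s', Runs inp B T p s s' ∧ Implements B s' σ'

section Leads

variable {inp : List ℕ} {B n d T T₁ T₂ : ℕ} {p q : Prog} {σ σ₁ σ₂ : State}

theorem Leads.mono (h : Leads inp B n d T₁ p σ σ₁) (hT : T₁ ≤ T₂) : Leads inp B n d T₂ p σ σ₁ :=
  fun hg => ⟨(h hg).1, fun s hs => ((h hg).2 s hs).imp fun _ h => ⟨h.1.mono hT, h.2⟩⟩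

theorem Leads.seq (h₁ : Leads inp B n d T₁ p σ σ₁) (h₂ : Leads inp B n d T₂ q σ₁ σ₂) :
    Leads inp B n d (1 + T₁ + T₂) (.seq p q) σ σ₂ := fun hg => by
  obtain ⟨hg₁, H₁⟩ := h₁ hg
  obtain ⟨hg₂, H₂⟩ := h₂ hg₁
  refine ⟨hg₂, fun s hs => ?_⟩
  obtain ⟨s₁, r₁, i₁⟩ := H₁ s hs
  obtain ⟨s₂, r₂, i₂⟩ := H₂ s₁ i₁
  exact ⟨s₂, r₁.seq r₂, i₂⟩

theorem leads_assign (hinp : ∀ a, inp.getD a 0 ≤ n + 1) (hB : (n + 2) ^ spaceDeg d ≤ B)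
    {x v : ℕ} {e : Expr} (he : e ∈ exprs d) (hx : 2 ≤ x ∧ x ≠ 7 ∧ x < 16)
    (hv : e.eval inp σ.mem (sizes n d) σ.env = v) (hvn : v ≤ n + 1) :
    Leads inp B n d (assignTime d n) (assign x e) σ (σ.setReg x v) := fun hg => by
  refine ⟨hg.setReg ⟨hx.1, hx.2.1⟩ hvn, fun s hs => ?_⟩
  rw [← hv]
  refine runs_assign (size := sizes n d) (le_refl n) (by simp [sizes]) hinp hB he hx.2.2 hg.mem_le
    (fun r hr => ?_) hg.size hs
  have h₁ : n + 1 ≤ (n + 1) ^ (3 * d + 1) := Nat.le_self_pow (by omega) _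
  by_cases hr1 : r = 1
  · subst hr1
    exact (hg.size true).trans_le (Nat.pow_le_pow_right (by omega) (by omega))
  · exact (hg.reg_le r hr hr1).trans h₁

theorem leads_store {x y : ℕ} (hx : x < 16) (hy : y < 16) (hv : σ.reg y ≤ 1) :
    Leads inp B n d 1 (.store x y) σ (σ.setMem (σ.reg x) (σ.reg y)) := fun hg => by
  refine ⟨⟨hg.size, hg.zero, hg.reg_le, fun a => ?_⟩, fun s hs => ⟨_, runs_store hs.fits, ?_⟩⟩
  · by_cases ha : a = σ.reg x
    · subst ha; simpa [State.setMem] using hv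
    · simpa [State.setMem, ha] using hg.mem_le a
  · refine ⟨(runs_store (inp := inp) (x := x) (y := y) hs.fits).fits_right, hs.reg, ?_, hs.buf,
      hs.out⟩
    simp [State.setMem, hs.mem, hs.reg x hx, hs.reg y hy]

theorem leads_skip : Leads inp B n d 1 .skip σ σ :=
  fun hg => ⟨hg, fun s hs => ⟨s, runs_skip hs.fits, hs⟩⟩

theorem leads_print {x : ℕ} (hx : x < 16) :
    Leads inp B n d 1 (.print x) σ { σ with buf := σ.buf ++ [σ.reg x] } := fun hg =>
  ⟨⟨hg.size, hg.zero, hg.reg_le, hg.mem_le⟩, fun s hs => ⟨_, runs_print hs.fits,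
    hs.fits, hs.reg, hs.mem, by simp [hs.buf, hs.reg x hx], hs.out⟩⟩

theorem leads_emit :
    Leads inp B n d 1 .emit σ { σ with buf := [], out := σ.out ++ [σ.buf] } := fun hg =>
  ⟨⟨hg.size, hg.zero, hg.reg_le, hg.mem_le⟩, fun s hs => ⟨_, runs_emit hs.fits,
    hs.fits, hs.reg, hs.mem, rfl, by simp [hs.buf, hs.out]⟩⟩

theorem Implements.test {s : State} (hs : Implements B s σ) {x y : ℕ} (hx : x < 16) (hy : y < 16) :
    (Test.lt x y).eval s.reg = decide (σ.reg x < σ.reg y) := by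
  simp [Test.eval, hs.reg x hx, hs.reg y hy]

theorem leads_ite {x y : ℕ} (hx : x < 16) (hy : y < 16)
    (h : Leads inp B n d T (if σ.reg x < σ.reg y then p else q) σ σ₁) :
    Leads inp B n d (1 + T) (.ite (.lt x y) p q) σ σ₁ := fun hg => by
  obtain ⟨hg₁, H⟩ := h hg
  refine ⟨hg₁, fun s hs => ?_⟩
  obtain ⟨s₁, r₁, i₁⟩ := H s hs
  refine ⟨s₁, Runs.ite ?_, i₁⟩
  simpa [hs.test hx hy] using r₁

/-- The loop rule for `Ram.Leads`. -/
theorem leads_loop {x y : ℕ} (hx : x < 16) (hy : y < 16) (I : State → Prop) (μ : State → ℕ)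
    (hbody : ∀ σ, Good n d σ → I σ → σ.reg x < σ.reg y →
      ∃ σ', Leads inp B n d T p σ σ' ∧ I σ' ∧ μ σ' < μ σ)
    (σ : State) (hg : Good n d σ) (hI : I σ) {N : ℕ} (hN : μ σ ≤ N) :
    ∃ σ', Leads inp B n d ((T + 1) * N + 1) (.loop (.lt x y) p) σ σ' ∧ Good n d σ' ∧ I σ' ∧
      ¬ σ'.reg x < σ'.reg y := by
  induction N generalizing σ with
  | zero =>
    have hlt : ¬ σ.reg x < σ.reg y := fun h => by
      obtain ⟨σ₁, -, -, h₁⟩ := hbody σ hg hI h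
      omega
    exact ⟨σ, fun _ => ⟨hg, fun s hs => ⟨s, (runs_loop_exit hs.fits
      (by simpa [hs.test hx hy] using hlt)).mono (by omega), hs⟩⟩, hg, hI, hlt⟩
  | succ N ih =>
    by_cases hlt : σ.reg x < σ.reg y
    · obtain ⟨σ₁, h₁, hI₁, hμ⟩ := hbody σ hg hI hlt
      obtain ⟨hg₁, H₁⟩ := h₁ hg
      obtain ⟨σ₂, h₂, hg₂, hI₂, ht₂⟩ := ih σ₁ hg₁ hI₁ (by omega)
      refine ⟨σ₂, fun _ => ⟨hg₂, fun s hs => ?_⟩, hg₂, hI₂, ht₂⟩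
      obtain ⟨s₁, r₁, i₁⟩ := H₁ s hs
      obtain ⟨s₂, r₂, i₂⟩ := (h₂ hg₁).2 s₁ i₁
      refine ⟨s₂, (r₁.loop (by simpa [hs.test hx hy] using hlt) r₂).mono ?_, i₂⟩
      linarith
    · exact ⟨σ, fun _ => ⟨hg, fun s hs => ⟨s, (runs_loop_exit hs.fits
        (by simpa [hs.test hx hy] using hlt)).mono (by omega), hs⟩⟩, hg, hI, hlt⟩

end Leads

/-! ### The phases of the search -/

section Phases

variable {n d B : ℕ} {inp : List ℕ} {P : PartialOrder (Fin n)} {ord : Fin d → LinearOrder (Fin n)}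
  {i₀ : Fin d} {L : List (Finset (Fin n))} {σ : State}

/-- The family of the minimal dominating sets of the incomparability graph of `P`. -/
abbrev Family (P : PartialOrder (Fin n)) : Set (Finset (Fin n)) :=
  {D | IsMinimalDominating (incompGraph P) D}

/-- The value of the negated extension test for the current vertex `c` and the set in the memory. -/
theorem eval_extendable_not (hP : ∀ x y, P.le x y ↔ ∀ i, (ord i).le x y)
    (h : Describes inp (incompGraph P) ord) (hi₀ : (i₀ : ℕ) = 0) {c : Fin n} (hc : σ.reg 3 = c) :
    (¬ (∃ D ∈ Family P, Agrees (DomEnum.rank (ord i₀)) (DomEnum.rank (ord i₀) c + 1) σ.mem D) →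
      (not (extendable d)).eval inp σ.mem (sizes n d) σ.env = 1) ∧
    ((∃ D ∈ Family P, Agrees (DomEnum.rank (ord i₀)) (DomEnum.rank (ord i₀) c + 1) σ.mem D) →
      (not (extendable d)).eval inp σ.mem (sizes n d) σ.env = 0) := by
  rw [← holds_extendable (ρ := σ.env) hP h hi₀ hc]
  simp only [Holds, eval_not]
  omega

/-- Descending turns an extendable prefix into a solution. -/
theorem leads_descend (hP : ∀ x y, P.le x y ↔ ∀ i, (ord i).le x y)
    (h : Describes inp (incompGraph P) ord) (hi₀ : (i₀ : ℕ) = 0) (hB : (n + 2) ^ spaceDeg d ≤ B)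
    (hg : Good n d σ) (hi : σ.reg 2 ≤ n)
    (hD : Descending (DomEnum.rank (ord i₀)) (Family P) L (σ.reg 2) σ.mem) :
    ∃ σ', Leads inp B n d ((4 * assignTime d n + 8) * n + 1) (descend d) σ σ' ∧ Good n d σ' ∧
      σ'.reg 2 = n ∧ Descending (DomEnum.rank (ord i₀)) (Family P) L n σ'.mem ∧
      σ'.buf = σ.buf ∧ σ'.out = σ.out := by
  obtain ⟨σ', hl, hg', ⟨hle, hD', hb, ho⟩, hexit⟩ := leads_loop (inp := inp) (B := B) (n := n)
    (d := d) (T := 4 * assignTime d n + 7) (x := 2) (y := 0) (by decide) (by decide)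
    (p := .seq (assign 3 vertex) (.seq (assign 5 (.const 0)) (.seq (.store 3 5)
      (.seq (assign 5 (not (extendable d))) (.seq (.store 3 5)
        (assign 2 (or (.var 2) (.const 1))))))))
    (fun τ => τ.reg 2 ≤ n ∧ Descending (DomEnum.rank (ord i₀)) (Family P) L (τ.reg 2) τ.mem ∧
      τ.buf = σ.buf ∧ τ.out = σ.out) (fun τ => n - τ.reg 2)
    (by
      rintro τ hgτ ⟨-, hD, hb, ho⟩ hlt
      rw [hgτ.reg_zero] at hlt
      obtain ⟨v, hv⟩ := exists_rank_eq (o := ord i₀) hlt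
      have l₁ := leads_assign (σ := τ) h.entry_le hB (e := vertex) (x := 3) (v := v)
        (by simp [exprs]) (by decide) (eval_vertex h hi₀ hv) (by omega)
      have l₂ := leads_assign (σ := τ.setReg 3 v) h.entry_le hB (e := .const 0) (x := 5) (v := 0)
        (by simp [exprs]) (by decide) rfl (by omega)
      have l₃ := leads_store (inp := inp) (B := B) (n := n) (d := d)
        (σ := (τ.setReg 3 v).setReg 5 0) (x := 3) (y := 5) (by decide) (by decide)
        (by simp [State.setReg])
      have e₃ : ((τ.setReg 3 v).setReg 5 0).setMem (((τ.setReg 3 v).setReg 5 0).reg 3)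
          (((τ.setReg 3 v).setReg 5 0).reg 5) = ((τ.setReg 3 v).setReg 5 0).setMem v 0 := by
        simp [State.setReg]
      rw [e₃] at l₃
      have key := eval_extendable_not (σ := ((τ.setReg 3 v).setReg 5 0).setMem v 0) (c := v) hP h
        hi₀ (by simp [State.setReg, State.setMem])
      -- the rest of the loop body, where `b` is the outcome of the test: insert `v` iff `b = 1`
      have finish (b : ℕ) (hb1 : b ≤ 1)
          (hval : (not (extendable d)).eval inp (((τ.setReg 3 v).setReg 5 0).setMem v 0).mem
            (sizes n d) (((τ.setReg 3 v).setReg 5 0).setMem v 0).env = b)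
          (hD' : Descending (DomEnum.rank (ord i₀)) (Family P) L (τ.reg 2 + 1)
            (Function.update τ.mem v b)) :
          ∃ σ', Leads inp B n d (4 * assignTime d n + 7) (.seq (assign 3 vertex)
            (.seq (assign 5 (.const 0)) (.seq (.store 3 5) (.seq (assign 5 (not (extendable d)))
              (.seq (.store 3 5) (assign 2 (or (.var 2) (.const 1)))))))) τ σ' ∧
            (σ'.reg 2 ≤ n ∧ Descending (DomEnum.rank (ord i₀)) (Family P) L (σ'.reg 2) σ'.mem ∧
              σ'.buf = σ.buf ∧ σ'.out = σ.out) ∧ n - σ'.reg 2 < n - τ.reg 2 := by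
        have l₄ := leads_assign h.entry_le hB (x := 5) (by simp [exprs]) (by decide) hval
          (by omega)
        have l₅ := leads_store (inp := inp) (B := B) (n := n) (d := d)
          (σ := (((τ.setReg 3 v).setReg 5 0).setMem v 0).setReg 5 b) (x := 3) (y := 5)
          (by decide) (by decide) (by simpa [State.setReg])
        have l₆ := leads_assign h.entry_le hB (e := or (.var 2) (.const 1)) (x := 2)
          (v := τ.reg 2 + 1) (σ := ((((τ.setReg 3 v).setReg 5 0).setMem v 0).setReg 5 b).setMem
            (((((τ.setReg 3 v).setReg 5 0).setMem v 0).setReg 5 b).reg 3)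
            (((((τ.setReg 3 v).setReg 5 0).setMem v 0).setReg 5 b).reg 5))
          (by simp [exprs]) (by decide)
          (by simp [eval_or, eval, State.env, varReg, State.setReg, State.setMem]) (by omega)
        refine ⟨_, (l₁.seq (l₂.seq (l₃.seq (l₄.seq (l₅.seq l₆))))).mono (by omega), ?_, ?_⟩
        · simp [State.setReg, State.setMem, hb, ho, hD', Nat.succ_le_of_lt hlt]
        · simp [State.setReg]; omega
      rw [hv] at key
      by_cases hex : ∃ D ∈ Family P, Agrees (DomEnum.rank (ord i₀)) (τ.reg 2 + 1)
          (Function.update τ.mem v 0) D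
      · exact finish 0 (by omega) (key.2 hex) (hD.omit rank_injective hv hex)
      · exact finish 1 (by omega) (key.1 hex) (hD.insert rank_injective hv hex))
    σ hg ⟨hi, hD, rfl, rfl⟩ (N := n) (by omega)
  have hn : σ'.reg 2 = n := by
    rw [hg'.reg_zero] at hexit; omega
  exact ⟨σ', hl, hg', hn, hn ▸ hD', hb, ho⟩

theorem lists_filter (A : ℕ → ℕ) :
    Lists ((List.range n).filter fun u => A u ≠ 0) (toSet n A) := by
  refine ⟨List.nodup_range.filter _, fun m => ?_⟩
  simp only [List.mem_filter, List.mem_range, toSet, Finset.mem_filter, Finset.mem_univ, true_and,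
    decide_eq_true_eq]
  exact ⟨fun h => ⟨⟨m, h.1⟩, h.2, rfl⟩, fun ⟨v, hv, e⟩ => e ▸ ⟨v.2, hv⟩⟩

theorem leads_output (hinp : ∀ a, inp.getD a 0 ≤ n + 1) (hB : (n + 2) ^ spaceDeg d ≤ B)
    (hg : Good n d σ) (hb : σ.buf = []) :
    ∃ σ', Leads inp B n d ((2 * assignTime d n + 5) * n + assignTime d n + 4) output σ σ' ∧
      Good n d σ' ∧ σ'.reg 2 = σ.reg 2 ∧ σ'.mem = σ.mem ∧ σ'.buf = [] ∧
      σ'.out = σ.out ++ [(List.range n).filter fun u => σ.mem u ≠ 0] := by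
  have l₁ := leads_assign (σ := σ) hinp hB (e := .const 0) (x := 4) (v := 0)
    (by simp [exprs]) (by decide) rfl (by omega)
  obtain ⟨σ', l₂, hg', ⟨hle, h2, hm, hb', ho⟩, hexit⟩ := leads_loop (inp := inp) (B := B) (n := n)
    (d := d) (T := 2 * assignTime d n + 4) (x := 4) (y := 0) (by decide) (by decide)
    (p := .seq (assign 5 (.load (.var 4))) (.seq (.ite (.lt 7 5) (.print 4) .skip)
      (assign 4 (or (.var 4) (.const 1)))))
    (fun τ => τ.reg 4 ≤ n ∧ τ.reg 2 = σ.reg 2 ∧ τ.mem = σ.mem ∧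
      τ.buf = (List.range (τ.reg 4)).filter (fun u => σ.mem u ≠ 0) ∧ τ.out = σ.out)
    (fun τ => n - τ.reg 4)
    (by
      rintro τ hgτ ⟨-, h2, hm, hb, ho⟩ hlt
      rw [hgτ.reg_zero] at hlt
      have k₁ := leads_assign (σ := τ) hinp hB (e := .load (.var 4)) (x := 5)
        (v := τ.mem (τ.reg 4)) (by simp [exprs]) (by decide) rfl
        ((hgτ.mem_le _).trans (by omega))
      by_cases h0 : σ.mem (τ.reg 4) = 0
      · have k₂ : Leads inp B n d 2 (.ite (.lt 7 5) (.print 4) .skip)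
            (τ.setReg 5 (τ.mem (τ.reg 4))) (τ.setReg 5 (τ.mem (τ.reg 4))) :=
          leads_ite (T := 1) (by decide) (by decide) (by
            rw [if_neg (by simp [State.setReg, hm, h0])]
            exact leads_skip)
        have k₃ := leads_assign (σ := τ.setReg 5 (τ.mem (τ.reg 4))) hinp hB
          (e := or (.var 4) (.const 1)) (x := 4) (v := τ.reg 4 + 1) (by simp [exprs]) (by decide)
          (by simp [eval_or, eval, State.env, varReg, State.setReg]) (by omega)
        refine ⟨_, (k₁.seq (k₂.seq k₃)).mono (by omega), ?_, ?_⟩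
        · simp [State.setReg, hm, ho, h2, hb, List.range_succ, h0, Nat.succ_le_of_lt hlt]
        · simp [State.setReg]; omega
      · have k₂ : Leads inp B n d 2 (.ite (.lt 7 5) (.print 4) .skip)
            (τ.setReg 5 (τ.mem (τ.reg 4))) _ := leads_ite (T := 1) (by decide) (by decide)
          (by
            rw [if_pos (by simp [State.setReg, hm, hgτ.zero]; omega)]
            exact leads_print (by decide))
        have k₃ := leads_assign (σ := { τ.setReg 5 (τ.mem (τ.reg 4)) with
            buf := (τ.setReg 5 (τ.mem (τ.reg 4))).buf ++ [(τ.setReg 5 (τ.mem (τ.reg 4))).reg 4] })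
          hinp hB
          (e := or (.var 4) (.const 1)) (x := 4) (v := τ.reg 4 + 1) (by simp [exprs]) (by decide)
          (by simp [eval_or, eval, State.env, varReg, State.setReg]) (by omega)
        refine ⟨_, (k₁.seq (k₂.seq k₃)).mono (by omega), ?_, ?_⟩
        · simp [State.setReg, hm, ho, h2, hb, List.range_succ, h0, Nat.succ_le_of_lt hlt]
        · simp [State.setReg]; omega)
    (σ.setReg 4 0) (hg.setReg (by decide) (by omega)) (by simp [State.setReg, hb]) (N := n)
    (by omega)
  have hn : σ'.reg 4 = n := by
    rw [hg'.reg_zero] at hexit; omega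
  have l₃ := leads_emit (inp := inp) (B := B) (n := n) (d := d) (σ := σ')
  refine ⟨_, (l₁.seq (l₂.seq l₃)).mono (by linarith), (l₃ hg').1, h2, hm, rfl, ?_⟩
  simp [ho, hb', hn]

/-- Ascending from a solution leads to the next extendable prefix, unless the enumeration is
complete. -/
theorem leads_ascend (hP : ∀ x y, P.le x y ↔ ∀ i, (ord i).le x y)
    (h : Describes inp (incompGraph P) ord) (hi₀ : (i₀ : ℕ) = 0) (hB : (n + 2) ^ spaceDeg d ≤ B)
    (hg : Good n d σ) (hi : σ.reg 2 = n)
    (hD : Returning (DomEnum.rank (ord i₀)) (Family P) L n σ.mem) :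
    ∃ σ', Leads inp B n d ((6 * assignTime d n + 8) * n + 3 * assignTime d n + 4) (ascend d) σ σ' ∧
      Good n d σ' ∧ σ'.buf = σ.buf ∧ σ'.out = σ.out ∧
      (σ'.reg 5 = 1 ∧ σ'.reg 2 ≤ n ∧
          Descending (DomEnum.rank (ord i₀)) (Family P) L (σ'.reg 2) σ'.mem ∨
        σ'.reg 5 = 0 ∧ ∀ D ∈ Family P, D ∈ L) := by
  have l₁ := leads_assign (σ := σ) h.entry_le hB (e := .const 0) (x := 5) (v := 0)
    (by simp [exprs]) (by decide) rfl (by omega)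
  have l₂ := leads_assign (σ := σ.setReg 5 0) h.entry_le hB (e := .var 2) (x := 4) (v := n)
    (by simp [exprs]) (by decide) (by simp [eval, State.env, varReg, State.setReg, hi]) (by omega)
  obtain ⟨σ', l₃, hg', ⟨hb, ho, h5, h4, hle, hret, hdes⟩, hexit⟩ := leads_loop (inp := inp)
    (B := B) (n := n) (d := d) (T := 6 * assignTime d n + 7) (x := 7) (y := 4) (by decide)
    (by decide)
    (p := .seq (assign 2 (.op .sub (.var 2) (.const 1))) (.seq (assign 3 vertex)
      (.seq (assign 6 (.load (.var 3))) (.seq (assign 5 (.const 1)) (.seq (.store 3 5)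
        (.seq (assign 5 (and (not (.var 6)) (not (not (extendable d)))))
          (assign 4 (and (not (.var 5)) (.var 2)))))))))
    -- register `4` is positive as long as no vertex to insert is found and some vertices are left;
    -- once it is found, the vertex of rank `τ.reg 2` is part of the prefix
    (fun τ => τ.buf = σ.buf ∧ τ.out = σ.out ∧ τ.reg 5 ≤ 1 ∧ τ.reg 4 = (1 - τ.reg 5) * τ.reg 2 ∧
      τ.reg 2 ≤ n ∧
      (τ.reg 5 = 0 → Returning (DomEnum.rank (ord i₀)) (Family P) L (τ.reg 2) τ.mem) ∧
      (τ.reg 5 = 1 → τ.reg 2 + 1 ≤ n ∧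
        Descending (DomEnum.rank (ord i₀)) (Family P) L (τ.reg 2 + 1) τ.mem))
    (fun τ => τ.reg 4)
    (by
      rintro τ hgτ ⟨hb, ho, h5, h4, hle, hret, -⟩ hlt
      rw [hgτ.zero, h4] at hlt
      have h50 : τ.reg 5 = 0 := by
        rcases Nat.le_one_iff_eq_zero_or_eq_one.1 h5 with h5 | h5
        · exact h5
        · simp [h5] at hlt
      rw [h50] at h4 hlt
      obtain ⟨i, hi⟩ : ∃ i, τ.reg 2 = i + 1 := Nat.exists_eq_succ_of_ne_zero (by omega)
      have hR := hret h50
      rw [hi] at hR hle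
      obtain ⟨v, hv⟩ := exists_rank_eq (o := ord i₀) (i := i) (by omega)
      have k₁ := leads_assign (σ := τ) h.entry_le hB (e := .op .sub (.var 2) (.const 1)) (x := 2)
        (v := i) (by simp [exprs]) (by decide)
        (by simp [eval, Op.eval, State.env, varReg, hi]) (by omega)
      have k₂ := leads_assign (σ := τ.setReg 2 i) h.entry_le hB (e := vertex) (x := 3) (v := v)
        (by simp [exprs]) (by decide) (eval_vertex h hi₀
          (by simp [State.env, varReg, State.setReg, hv])) (by omega)
      have k₃ := leads_assign (σ := (τ.setReg 2 i).setReg 3 v) h.entry_le hB (e := .load (.var 3))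
        (x := 6) (v := τ.mem v) (by simp [exprs]) (by decide)
        (by simp [eval, State.env, varReg, State.setReg]) ((hgτ.mem_le _).trans (by omega))
      have k₄ := leads_assign (σ := ((τ.setReg 2 i).setReg 3 v).setReg 6 (τ.mem v)) h.entry_le hB
        (e := .const 1) (x := 5) (v := 1) (by simp [exprs]) (by decide) rfl (by omega)
      have k₅ := leads_store (inp := inp) (B := B) (n := n) (d := d)
        (σ := (((τ.setReg 2 i).setReg 3 v).setReg 6 (τ.mem v)).setReg 5 1) (x := 3) (y := 5)
        (by decide) (by decide) (by simp [State.setReg])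
      obtain ⟨τ', hτ'⟩ : ∃ τ', τ' =
        ((((τ.setReg 2 i).setReg 3 v).setReg 6 (τ.mem v)).setReg 5 1).setMem v 1 := ⟨_, rfl⟩
      replace k₅ : Leads inp B n d 1 (.store 3 5)
          ((((τ.setReg 2 i).setReg 3 v).setReg 6 (τ.mem v)).setReg 5 1) τ' := by
        rw [hτ']; simpa [State.setReg] using k₅
      have key := eval_extendable_not (σ := τ') (c := v) hP h hi₀
        (by simp [hτ', State.setReg, State.setMem])
      have r2 : τ'.reg 2 = i := by simp [hτ', State.setReg, State.setMem]
      have r6 : τ'.reg 6 = τ.mem v := by simp [hτ', State.setReg, State.setMem]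
      have rm : τ'.mem = Function.update τ.mem v 1 := by simp [hτ', State.setReg, State.setMem]
      have rb : τ'.buf = σ.buf := by simp [hτ', State.setReg, State.setMem, hb]
      have ro : τ'.out = σ.out := by simp [hτ', State.setReg, State.setMem, ho]
      -- the rest of the loop body, where `b` tells whether `v` was omitted and can be inserted
      have finish (b : ℕ) (hb1 : b ≤ 1)
          (hval : (1 - τ.mem v) *
            (1 - (not (extendable d)).eval inp τ'.mem (sizes n d) τ'.env) = b)
          (h₀ : b = 0 → Returning (DomEnum.rank (ord i₀)) (Family P) L i τ'.mem)
          (h₁ : b = 1 → Descending (DomEnum.rank (ord i₀)) (Family P) L (i + 1) τ'.mem) :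
          ∃ σ', Leads inp B n d (6 * assignTime d n + 7)
            (.seq (assign 2 (.op .sub (.var 2) (.const 1))) (.seq (assign 3 vertex)
              (.seq (assign 6 (.load (.var 3))) (.seq (assign 5 (.const 1)) (.seq (.store 3 5)
                (.seq (assign 5 (and (not (.var 6)) (not (not (extendable d)))))
                  (assign 4 (and (not (.var 5)) (.var 2))))))))) τ σ' ∧
            (σ'.buf = σ.buf ∧ σ'.out = σ.out ∧ σ'.reg 5 ≤ 1 ∧
              σ'.reg 4 = (1 - σ'.reg 5) * σ'.reg 2 ∧ σ'.reg 2 ≤ n ∧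
              (σ'.reg 5 = 0 →
                Returning (DomEnum.rank (ord i₀)) (Family P) L (σ'.reg 2) σ'.mem) ∧
              (σ'.reg 5 = 1 → σ'.reg 2 + 1 ≤ n ∧
                Descending (DomEnum.rank (ord i₀)) (Family P) L (σ'.reg 2 + 1) σ'.mem)) ∧
            σ'.reg 4 < τ.reg 4 := by
        have k₆ := leads_assign (σ := τ') h.entry_le hB
          (e := and (not (.var 6)) (not (not (extendable d)))) (x := 5) (v := b)
          (by simp [exprs]) (by decide)
          (by
            rw [← hval, eval_and, eval_not, eval_not (e := not (extendable d))]
            simp [eval, State.env, varReg, r6]) (by omega)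
        have hbi : (1 - b) * i ≤ i := (Nat.mul_le_mul_right i (Nat.sub_le 1 b)).trans (by omega)
        have k₇ := leads_assign (σ := τ'.setReg 5 b) h.entry_le hB
          (e := and (not (.var 5)) (.var 2)) (x := 4) (v := (1 - b) * i)
          (by simp [exprs]) (by decide)
          (by simp [eval, eval_and, eval_not, State.env, varReg, State.setReg, r2]) (by omega)
        refine ⟨_, (k₁.seq (k₂.seq (k₃.seq (k₄.seq (k₅.seq (k₆.seq k₇)))))).mono (by omega),
          ⟨rb, ro, ?_, ?_, ?_, ?_, ?_⟩, ?_⟩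
        · simpa [State.setReg] using hb1
        · simp [State.setReg, r2]
        · simp [State.setReg, r2]; omega
        · simpa [State.setReg, r2] using h₀
        · simpa [State.setReg, r2, hle] using h₁
        · simp [State.setReg, h4, hi]; omega
      rw [hv, rm] at key
      by_cases hA : τ.mem v = 0
      · by_cases hex : ∃ D ∈ Family P, Agrees (DomEnum.rank (ord i₀)) (i + 1)
            (Function.update τ.mem v 1) D
        · refine finish 1 le_rfl (by rw [rm, key.2 hex, hA]) (fun h => by omega) fun _ => ?_
          rw [rm]; exact hR.turn rank_injective hv hA hex
        · refine finish 0 (by omega) (by rw [rm, key.1 hex, hA]) (fun _ => ?_) fun h => by omega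
          rw [rm]; exact hR.of_eq_zero rank_injective hv hA hex
      · refine finish 0 (by omega) ?_ (fun _ => ?_) fun h => by omega
        · rw [show 1 - τ.mem v = 0 by omega, zero_mul]
        · rw [rm]; exact hR.of_ne_zero rank_injective hv hA)
    ((σ.setReg 5 0).setReg 4 n)
    ((hg.setReg (by decide) (by omega)).setReg (by decide) (by omega))
    (by simpa [State.setReg, hi] using hD) (N := n) (by simp [State.setReg])
  have hsum : σ'.reg 2 + σ'.reg 5 ≤ n := by
    rcases Nat.le_one_iff_eq_zero_or_eq_one.1 h5 with h5 | h5
    · omega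
    · have := (hdes h5).1; omega
  have l₄ := leads_assign (σ := σ') h.entry_le hB (e := or (.var 2) (.var 5)) (x := 2)
    (v := σ'.reg 2 + σ'.reg 5) (by simp [exprs]) (by decide) rfl (by omega)
  refine ⟨_, (l₁.seq (l₂.seq (l₃.seq l₄))).mono (by linarith), (l₄ hg').1, hb, ho, ?_⟩
  rcases Nat.le_one_iff_eq_zero_or_eq_one.1 h5 with h5 | h5
  · refine Or.inr ⟨by simp [State.setReg, h5], fun D hD => ?_⟩
    have h20 : σ'.reg 2 = 0 := by
      rw [hg'.zero, h4, h5] at hexit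
      omega
    have hR := hret h5
    rw [h20] at hR
    exact hR.mem_of_zero hD
  · refine Or.inl ⟨by simp [State.setReg, h5], by simpa [State.setReg] using hsum, ?_⟩
    simpa [State.setReg, h5] using (hdes h5).2

end Phases

/-! ### The whole run -/

section Main

variable {n d B : ℕ} {inp : List ℕ} {P : PartialOrder (Fin n)} {ord : Fin d → LinearOrder (Fin n)}
  {i₀ : Fin d} {L : List (Finset (Fin n))} {σ : State}

/-- A bound for the time of a round of the main loop, including the setup or the exit from the loop.
It is half of the bound for the delay, as a solution is output in the middle of a round. -/
def roundTime (d n : ℕ) : ℕ := 40 * (assignTime d n * (n + 1))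

theorem four_le_assignTime (d n : ℕ) : 4 ≤ assignTime d n :=
  Nat.le_mul_of_pos_right _ (by positivity) |>.trans' (Nat.le_add_left _ _)

/-- A round outputs the lexicographically next solution `D`. -/
theorem leads_round (hP : ∀ x y, P.le x y ↔ ∀ i, (ord i).le x y)
    (h : Describes inp (incompGraph P) ord) (hi₀ : (i₀ : ℕ) = 0) (hB : (n + 2) ^ spaceDeg d ≤ B)
    (hg : Good n d σ) (hi : σ.reg 2 ≤ n) (hb : σ.buf = [])
    (hD : Descending (DomEnum.rank (ord i₀)) (Family P) L (σ.reg 2) σ.mem) :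
    ∃ σ' D l, Leads inp B n d (33 * (assignTime d n * (n + 1))) (round d) σ σ' ∧ Good n d σ' ∧
      σ'.buf = [] ∧ σ'.out = σ.out ++ [l] ∧ Lists l D ∧ D ∈ Family P ∧ D ∉ L ∧
      (σ'.reg 5 = 1 ∧ σ'.reg 2 ≤ n ∧
          Descending (DomEnum.rank (ord i₀)) (Family P) (L ++ [D]) (σ'.reg 2) σ'.mem ∨
        σ'.reg 5 = 0 ∧ ∀ D' ∈ Family P, D' ∈ L ++ [D]) := by
  obtain ⟨σ₁, l₁, g₁, i₁, d₁, b₁, o₁⟩ := leads_descend hP h hi₀ hB hg hi hD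
  obtain ⟨hF, hnot, hret⟩ := d₁.found (rank_lt _)
  obtain ⟨σ₂, l₂, g₂, i₂, m₂, b₂, o₂⟩ := leads_output h.entry_le hB g₁ (b₁.trans hb)
  rw [← m₂] at hret
  obtain ⟨σ₃, l₃, g₃, b₃, o₃, H⟩ := leads_ascend hP h hi₀ hB g₂ (i₂.trans i₁) hret
  refine ⟨σ₃, toSet n σ₁.mem, _, (l₁.seq (l₂.seq l₃)).mono ?_, g₃, b₃.trans b₂, ?_,
    lists_filter σ₁.mem, hF, hnot, by rwa [m₂] at H⟩
  · have h₁ := four_le_assignTime d n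
    nlinarith [Nat.mul_le_mul_right n h₁]
  · rw [o₃, o₂, o₁]

/-- The final configuration holds the complete enumeration of `F`. -/
def Complete (F : Set (Finset (Fin n))) (c : Config) : Prop :=
  c.buf = [] ∧ ∃ L : List (Finset (Fin n)), L.Nodup ∧ (∀ D, D ∈ L ↔ D ∈ F) ∧
    List.Forall₂ Lists c.out L

/-- The main loop, from any moment at which an extendable prefix is at hand. Each round outputs a
set that has not been output before, so the number `N` of the remaining sets bounds the number of
rounds. -/
theorem finishes_loop (hP : ∀ x y, P.le x y ↔ ∀ i, (ord i).le x y)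
    (h : Describes inp (incompGraph P) ord) (hi₀ : (i₀ : ℕ) = 0) (hB : (n + 2) ^ spaceDeg d ≤ B)
    (N : ℕ) {s : State} (hs : Implements B s σ) (hg : Good n d σ) (h5 : σ.reg 5 = 1)
    (hi : σ.reg 2 ≤ n) (hb : σ.buf = [])
    (hD : Descending (DomEnum.rank (ord i₀)) (Family P) L (σ.reg 2) σ.mem) (hL : L.Nodup)
    (hLF : ∀ D ∈ L, D ∈ Family P) (hout : List.Forall₂ Lists σ.out L)
    (hN : Fintype.card (Finset (Fin n)) ≤ L.length + N) :
    Progress inp (roundTime d n) (s.at [.loop (.lt 7 5) (round d)]) ∧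
      Finishes inp B (roundTime d n) (Complete (Family P)) (s.at [.loop (.lt 7 5) (round d)]) := by
  induction N using Nat.strong_induction_on generalizing s σ L with
  | _ N ih =>
    have h₄ : 4 ≤ assignTime d n * (n + 1) :=
      (four_le_assignTime d n).trans (Nat.le_mul_of_pos_right _ (Nat.succ_pos n))
    obtain ⟨σ', D, l, hl, g', b', o', hlD, hDF, hDL, hcase⟩ := leads_round hP h hi₀ hB hg hi hb hD
    obtain ⟨s', r', hs'⟩ := (hl hg).2 s hs
    have htest : (Test.lt 7 5).eval s.reg = true := by
      rw [hs.test (by decide) (by decide)]; simp [hg.zero, h5]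
    have hreach := ((reach_loop (k := []) hs.fits htest).trans (r' _))
    have hL' : (L ++ [D]).Nodup := by
      rw [List.nodup_append]
      refine ⟨hL, by simp, ?_⟩
      rintro a ha b hb rfl
      exact hDL (List.mem_singleton.1 hb ▸ ha)
    have hLF' : ∀ D' ∈ L ++ [D], D' ∈ Family P := by
      intro D' hD'
      rcases List.mem_append.1 hD' with hD' | hD'
      · exact hLF D' hD'
      · exact List.mem_singleton.1 hD' ▸ hDF
    have hout' : List.Forall₂ Lists σ'.out (L ++ [D]) := by
      rw [o']; exact List.rel_append hout (.cons hlD .nil)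
    have hgrow : (s.at [.loop (.lt 7 5) (round d)]).out.length <
        (s'.at [.loop (.lt 7 5) (round d)]).out.length := by
      simp [State.at, hs.out, hs'.out, o']
    refine ⟨Progress.of_reach hreach ?_ (Or.inr hgrow), ?_⟩
    · simp only [roundTime]; omega
    have hreach' := hreach.mono (T₂ := roundTime d n) (by simp only [roundTime]; omega)
    rcases hcase with ⟨h5', hi', hD'⟩ | ⟨h5', hall⟩
    · have hcard := hL'.length_le_card
      simp only [List.length_append, List.length_singleton] at hcard
      obtain ⟨hp, hf⟩ := ih (N - 1) (by omega) hs' g' h5' hi' b' hD' hL' hLF' hout'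
        (by rw [List.length_append, List.length_singleton]; omega)
      exact Finishes.of_reach hreach' hp hf
    · have htest' : (Test.lt 7 5).eval s'.reg = false := by
        rw [hs'.test (by decide) (by decide)]; simp [h5']
      have hexit := reach_loop_exit (inp := inp) (p := round d) (k := []) hs'.fits htest'
      have hend : Finishes inp B (roundTime d n) (Complete (Family P)) (s'.at []) := by
        refine finishes_of_halted rfl ⟨hs'.buf.trans b', L ++ [D], hL',
          fun D' => ⟨hLF' D', hall D'⟩, ?_⟩ hs'.fits
        simpa [State.at, hs'.out] using hout'
      have h1 : 1 ≤ roundTime d n := by simp only [roundTime]; omega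
      refine Finishes.of_reach hreach' (Progress.of_reach hexit h1 (Or.inl rfl)) ?_
      exact Finishes.of_reach (hexit.mono h1) ⟨0, Nat.zero_le _, Or.inl rfl⟩ hend

theorem finishes_enumerate (hP : ∀ x y, P.le x y ↔ ∀ i, (ord i).le x y)
    (h : Describes inp (incompGraph P) ord) (hi₀ : (i₀ : ℕ) = 0)
    (hB : (n + 2) ^ spaceDeg d ≤ B) :
    Finishes inp B (roundTime d n) (Complete (Family P)) (init (enumerate d)) := by
  have hB0 : 0 < B := (Nat.pow_pos (by omega)).trans_le hB
  obtain ⟨σ₀, hσ₀⟩ : ∃ σ₀ : State, σ₀ = ⟨fun _ => 0, fun _ => 0, [], []⟩ := ⟨_, rfl⟩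
  have i₀' : Implements B σ₀ σ₀ :=
    ⟨by subst hσ₀; exact ⟨fun _ => hB0, fun _ => hB0, fun _ _ => rfl⟩,
      fun _ _ => rfl, rfl, rfl, rfl⟩
  have hn : n ≤ (n + 1) ^ (3 * d + 1) := (Nat.le_succ n).trans (Nat.le_self_pow (by omega) _)
  obtain ⟨s₁, r₁, i₁⟩ := runs_assign (size := fun _ => 0) (x := 0) (e := .input (.const 0))
    (Nat.zero_le n) (Nat.zero_le _) h.entry_le hB (by simp [exprs]) (by decide)
    (by simp [hσ₀]) (by simp [hσ₀]) (by simp [hσ₀]) i₀'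
  rw [show (Expr.input (.const 0)).eval inp σ₀.mem (fun _ => 0) σ₀.env = n from h.size] at i₁
  obtain ⟨s₂, r₂, i₂⟩ := runs_assign (size := fun big => if big then 0 else n) (x := 1)
    (e := pow (3 * d)) (n := n) (by simp) (by simp) h.entry_le hB (by simp [exprs]) (by decide)
    (by simp [hσ₀, State.setReg])
    (fun r _ => by
      by_cases hr : r = 0
      · subst hr; simpa [State.setReg] using hn
      · simp [State.setReg, hσ₀, hr])
    (fun big => by cases big <;> simp [sizeReg, State.setReg, hσ₀]) i₁
  rw [eval_pow] at i₂
  have g₂ : Good n d ((σ₀.setReg 0 n).setReg 1 ((n + 1) ^ (3 * d))) := by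
    refine ⟨fun big => by cases big <;> simp [sizeReg, State.setReg, sizes], by
      simp [State.setReg, hσ₀], fun r _ hr1 => ?_, by simp [State.setReg, hσ₀]⟩
    by_cases hr : r = 0
    · subst hr; simp [State.setReg]
    · simp [State.setReg, hσ₀, hr, hr1]
  obtain ⟨g₃, H⟩ := leads_assign (e := .const 1) (x := 5) (v := 1) h.entry_le hB (by simp [exprs])
    (by decide) rfl (by omega) g₂
  obtain ⟨s₃, r₃, i₃⟩ := H s₂ i₂
  have hF : (Family P).Nonempty := exists_isMinimalDominating_univ _
  obtain ⟨hp, hf⟩ := finishes_loop (L := []) hP h hi₀ hB (Fintype.card (Finset (Fin n))) i₃ g₃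
    (by simp [State.setReg]) (by simp [State.setReg, hσ₀]) (by simp [State.setReg, hσ₀])
    (by simpa [State.setReg, hσ₀] using descending_zero hF) List.nodup_nil (by simp)
    (by simp [State.setReg, hσ₀]) (by simp)
  have hinit : init (enumerate d) = σ₀.at [enumerate d] := by subst hσ₀; rfl
  rw [hinit]
  have h₄ := four_le_assignTime d n
  refine Finishes.of_reach (((reach_seq i₀'.fits).trans ((r₁.seq (r₂.seq r₃)) _)).mono ?_) hp hf
  simp only [roundTime]
  nlinarith

/-- The enumeration is correct, and obeys the bounds for delay and space. The constant in the bound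
for the delay depends on `d` only. -/
theorem enumerate_spec (hd : 0 < d) (hP : ∀ x y, P.le x y ↔ ∀ i, (ord i).le x y)
    (h : Describes inp (incompGraph P) ord) :
    Enumerates (enumerate d) inp (Family P) ∧
      DelayAtMost (enumerate d) inp
        (80 * (((exprs d).map timeConst).sum + 4) * (n + 1) ^ (3 * d + 4)) ∧
      SpaceAtMost (enumerate d) inp ((n + 2) ^ spaceDeg d) := by
  have hf := finishes_enumerate (i₀ := ⟨0, hd⟩) hP h rfl le_rfl
  refine ⟨?_, fun t => ?_, hf.fits⟩
  · obtain ⟨T, hT, hb, hL⟩ := hf.final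
    exact ⟨T, hT, hb, hL⟩
  · obtain ⟨s, hs, H⟩ := hf.progress t
    refine ⟨s, hs.trans (le_of_eq ?_), ?_⟩
    · rw [roundTime, assignTime, pow_succ (n + 1) (3 * d + 3)]; ring
    · rw [← Function.iterate_add_apply, add_comm s t] at H
      exact H

end Main

end Ram

/-! ### The input -/

namespace DomEnum

section Input

variable {n : ℕ}

theorem length_matrixCode (r : Fin n → Fin n → Prop) : (matrixCode r).length = n * n := by
  simp [matrixCode]

theorem mul_add_lt (u v : Fin n) : (u * n + v : ℕ) < n * n :=
  calc (u * n + v : ℕ) < u * n + n := by omega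
    _ = (u + 1) * n := by ring
    _ ≤ n * n := Nat.mul_le_mul_right n u.2

open Classical in
theorem getD_matrixCode (r : Fin n → Fin n → Prop) (u v : Fin n) :
    (matrixCode r).getD (u * n + v) 0 = if r u v then 1 else 0 := by
  have hn : 0 < n := u.pos
  rw [List.getD_eq_getElem _ _ (by rw [length_matrixCode]; exact mul_add_lt u v)]
  simp only [matrixCode, List.getElem_ofFn]
  congr 2
  · exact Fin.ext (by simp [Fin.divNat, Nat.add_div_of_dvd_right, Nat.div_eq_of_lt, hn, mul_comm])
  · exact Fin.ext (by simp [Fin.modNat, Nat.mod_eq_of_lt])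

theorem getD_flatMap {ι : Type*} (f : ι → List ℕ) {m : ℕ} (hf : ∀ i, (f i).length = m)
    (l : List ι) {j : ℕ} (hj : j < l.length) {r : ℕ} (hr : r < m) :
    (l.flatMap f).getD (m * j + r) 0 = (f l[j]).getD r 0 := by
  induction l generalizing j with
  | nil => simp at hj
  | cons a l ih =>
    rw [List.flatMap_cons]
    cases j with
    | zero => rw [List.getD_append _ _ _ _ (by rw [hf]; omega)]; simp
    | succ j =>
      have e : m * (j + 1) + r = m + (m * j + r) := by ring
      rw [List.getD_append_right _ _ _ _ (by rw [hf]; omega), hf, e, Nat.add_sub_cancel_left,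
        ih (by simpa using hj)]
      simp

theorem mem_inputCode_le {d : ℕ} {G : SimpleGraph (Fin n)} {ord : Fin d → LinearOrder (Fin n)}
    {a : ℕ} (ha : a ∈ inputCode G ord) : a ≤ n + 1 := by
  have hmat : ∀ r : Fin n → Fin n → Prop, a ∈ matrixCode r → a ≤ n + 1 := fun r ha => by
    simp only [matrixCode, List.mem_ofFn] at ha
    obtain ⟨k, rfl⟩ := ha
    split <;> omega
  simp only [inputCode, List.mem_cons, List.mem_append, List.mem_flatMap] at ha
  rcases ha with rfl | ha | ⟨i, -, ha⟩
  · omega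
  · exact hmat _ ha
  · exact hmat _ ha

variable {d : ℕ} (G : SimpleGraph (Fin n)) (ord : Fin d → LinearOrder (Fin n))

theorem getD_inputCode_le (a : ℕ) : (inputCode G ord).getD a 0 ≤ n + 1 := by
  by_cases h : a < (inputCode G ord).length
  · rw [List.getD_eq_getElem _ _ h]
    exact mem_inputCode_le (List.getElem_mem h)
  · rw [List.getD_eq_default _ _ (by omega)]
    omega

theorem getD_inputCode_adj (u v : Fin n) :
    (inputCode G ord).getD (1 + (u * n + v)) 0 ≠ 0 ↔ G.Adj u v := by
  rw [inputCode, add_comm 1, List.getD_cons_succ, List.getD_append _ _ _ _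
    (by rw [length_matrixCode]; exact mul_add_lt u v), getD_matrixCode]
  simp

theorem getD_inputCode_ord (j : Fin d) (u v : Fin n) :
    (inputCode G ord).getD (1 + (n * n * (j + 1) + (u * n + v))) 0 ≠ 0 ↔ (ord j).le u v := by
  have e : n * n * (j + 1) + (u * n + v : ℕ) = n * n + (n * n * j + (u * n + v)) := by ring
  rw [inputCode, add_comm 1, List.getD_cons_succ, e, List.getD_append_right _ _ _ _
    (by rw [length_matrixCode]; omega), length_matrixCode, Nat.add_sub_cancel_left,
    getD_flatMap (fun i => matrixCode (ord i).le) (fun i => length_matrixCode _) _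
      (by simp) (mul_add_lt u v), getD_matrixCode]
  have hj : (List.finRange d)[(j : ℕ)]'(by simp) = j := by simp
  rw [hj]
  simp

theorem describes_inputCode : Ram.Expr.Describes (inputCode G ord) G ord where
  size := rfl
  adj := getD_inputCode_adj G ord
  le j u v _ := getD_inputCode_ord G ord j u v
  entry_le := getD_inputCode_le G ord

end Input

end DomEnum

theorem theorem1 (d : ℕ) :
    ∃ (prog : Ram.Prog) (C k : ℕ),
      ∀ (n : ℕ) (P : PartialOrder (Fin n)) (ord : Fin d → LinearOrder (Fin n)),
        (∀ x y, P.le x y ↔ ∀ i, (ord i).le x y) →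
          DomEnum.Enumerates prog (DomEnum.inputCode (DomEnum.incompGraph P) ord)
              {D | DomEnum.IsMinimalDominating (DomEnum.incompGraph P) D} ∧
            Ram.DelayAtMost prog (DomEnum.inputCode (DomEnum.incompGraph P) ord)
              (C * (n + 1) ^ (3 * d + 4)) ∧
            Ram.SpaceAtMost prog (DomEnum.inputCode (DomEnum.incompGraph P) ord)
              ((n + 2) ^ k) := by
  rcases Nat.eq_zero_or_pos d with rfl | hd
  · -- without linear orders, there is at most one vertex, so that any linear order will do
    refine ⟨Ram.enumerate 1, 80 * (((Ram.exprs 1).map Ram.Expr.timeConst).sum + 4) * 8,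
      Ram.spaceDeg 1, fun n P ord hP => ?_⟩
    have hle : ∀ x y, P.le x y := fun x y => (hP x y).2 fun i => i.elim0
    have hsub : ∀ x y : Fin n, x = y := fun x y => P.le_antisymm x y (hle x y) (hle y x)
    have hn : n ≤ 1 := by
      by_contra h
      have := hsub ⟨0, by omega⟩ ⟨1, by omega⟩
      simp at this
    obtain ⟨h₁, h₂, h₃⟩ := Ram.enumerate_spec (d := 1) (P := P)
      (inp := DomEnum.inputCode (DomEnum.incompGraph P) ord)
      (ord := fun _ => inferInstanceAs (LinearOrder (Fin n))) one_pos
      (fun x y => ⟨fun _ _ => by rw [hsub x y]; exact Nat.le_refl _, fun _ => hle x y⟩)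
      ⟨rfl, DomEnum.getD_inputCode_adj _ _, fun j u v huv => (huv (hsub u v)).elim,
        DomEnum.getD_inputCode_le _ _⟩
    refine ⟨h₁, fun t => ?_, h₃⟩
    obtain ⟨s, hs, H⟩ := h₂ t
    refine ⟨s, hs.trans ?_, H⟩
    have h8 : (n + 1) ^ 3 ≤ 8 := Nat.pow_le_pow_left (by omega : n + 1 ≤ 2) 3
    calc _ = 80 * (((Ram.exprs 1).map Ram.Expr.timeConst).sum + 4) * (n + 1) ^ 3 *
          (n + 1) ^ (3 * 0 + 4) := by ring
      _ ≤ _ := Nat.mul_le_mul_right _ (Nat.mul_le_mul_left _ h8)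
  · exact ⟨Ram.enumerate d, _, Ram.spaceDeg d, fun n P ord hP =>
      Ram.enumerate_spec hd hP (DomEnum.describes_inputCode _ ord)⟩
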